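/- For every $n\ge 1$ let $M=n^{-1/2}W$, where $W=\{W^{(n)}_{jk}\}_{j,k=1}^n$ is a real symmetric random matrix whose entries $W^{(n)}_{jk}$, $1\le j\le k\le n$, are independent with $\mathbf{E}\{W^{(n)}_{jk}\}=0$ and $\mathbf{E}\{(W^{(n)}_{jk})^2\}=w^2(1+\delta_{jk})$. Assume that (i) the third moments $\mathbf{E}\{(W^{(n)}_{jk})^3\}=\mu_3$ do not depend on $j$, $k$ and $n$; (ii) the sixth moments are uniformly bounded: $\mathbf{E}\{(W^{(n)}_{jk})^6\}\le w_6<\infty$ for all $n$ and all $1\le j,k\le n$. Then there is a constant $C$, depending only on $w$ and $w_6$ (in particular not on $n$, $j$, $t$ and $\varphi$), such that the following holds for all $n$ and all $1\le j\le n$, where $\mathbf{Var}\{X\}=\mathbf{E}\{|X-\mathbf{E}\{X\}|^2\}$ for a complex random variable $X$. For every continuous function $\varphi:\mathbb{R}\to\mathbb{C}$ whose Fourier transform $$\widehat\varphi(t)=\frac1{2\pi}\int e^{-it\lambda}\varphi(\lambda)\,d\lambda$$ (understood in the sense of tempered distributions if $\varphi$ is not integrable) is a function with $\int(1+|t|)^3|\widehat\varphi(t)|\,dt<\infty$,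 the random variable $\varphi_{jj}(M)$, the $j$-th diagonal entry of $\varphi(M)$, is square integrable and $$\mathbf{Var}\{\sqrt n\,\varphi_{jj}(M)\}\le C\Big(\int(1+|t|)^3|\widehat\varphi(t)|\,dt\Big)^2.$$ Moreover, for $U(t)=e^{itM}$ and every $t\in\mathbb{R}$, $$\mathbf{Var}\{U_{jj}(t)\}\le \frac{C(1+|t|)^6}{n}.$$ -/

import Mathlib

open MeasureTheory ProbabilityTheory
open scoped SchwartzMap

/-- `W n`, `n = 1, 2, …`, is a sequence of unnormalized real symmetric Wigner matrices: the entries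
`W n j k`, `j ≤ k`, are independent, centered, with variance `w² (1 + δ_{jk})`.
The matrices of different sizes may live on different probability spaces. -/
structure IsWigner (w : ℝ) {Ω : ℕ → Type*} [∀ n, MeasurableSpace (Ω n)]
    (P : ∀ n, Measure (Ω n)) (W : ∀ n, Ω n → Matrix (Fin n) (Fin n) ℝ) : Prop where
  symm : ∀ n ω, (W n ω).IsSymm
  measurable : ∀ n j k, Measurable fun ω => W n ω j k
  indep : ∀ n, iIndepFun
    (fun (p : {p : Fin n × Fin n // p.1 ≤ p.2}) (ω : Ω n) => W n ω p.1.1 p.1.2) (P n)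
  memLp_two : ∀ n j k, MemLp (fun ω => W n ω j k) 2 (P n)
  mean : ∀ n j k, ∫ ω, W n ω j k ∂(P n) = 0
  second_moment : ∀ n j k, ∫ ω, (W n ω j k) ^ 2 ∂(P n) = w ^ 2 * (1 + if j = k then 1 else 0)

/-- The normalized matrix `M = n^{-1/2} W`. -/
noncomputable def normalized {n : ℕ} (A : Matrix (Fin n) (Fin n) ℝ) : Matrix (Fin n) (Fin n) ℝ :=
  (Real.sqrt n)⁻¹ • A

theorem IsWigner.isHermitian {w : ℝ} {Ω : ℕ → Type*} [∀ n, MeasurableSpace (Ω n)]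
    {P : ∀ n, Measure (Ω n)} {W : ∀ n, Ω n → Matrix (Fin n) (Fin n) ℝ}
    (hW : IsWigner w P W) (n : ℕ) (ω : Ω n) : (normalized (W n ω)).IsHermitian := by
  have h := hW.symm n ω
  rw [Matrix.IsSymm] at h
  simp [normalized, Matrix.IsHermitian,
    Matrix.conjTranspose_eq_transpose_of_trivial, h]

/-- The function `φ(A)` of a real symmetric matrix `A`, for a complex-valued `φ` on the line:
if `A = O diag(λ) Oᵀ` with `O` orthogonal, then `φ(A) = O diag(φ(λ)) Oᵀ`. -/
noncomputable def matFun {n : ℕ} {A : Matrix (Fin n) (Fin n) ℝ} (hA : A.IsHermitian)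
    (φ : ℝ → ℂ) : Matrix (Fin n) (Fin n) ℂ :=
  ((hA.eigenvectorUnitary : Matrix (Fin n) (Fin n) ℝ).map Complex.ofReal) *
    Matrix.diagonal (fun a => φ (hA.eigenvalues a)) *
    ((hA.eigenvectorUnitary : Matrix (Fin n) (Fin n) ℝ).map Complex.ofReal).transpose

/-- The unitary matrix `U(t) = e^{itA}` of a real symmetric matrix `A`. -/
noncomputable def unitaryExp {n : ℕ} (A : Matrix (Fin n) (Fin n) ℝ) (t : ℝ) :
    Matrix (Fin n) (Fin n) ℂ :=
  NormedSpace.exp ((Complex.I * (t : ℂ)) • A.map Complex.ofReal)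

/-- The variance `E |X - E X|²` of a complex random variable. -/
noncomputable def complexVar {Ω : Type*} [MeasurableSpace Ω] (P : Measure Ω) (X : Ω → ℂ) : ℝ :=
  ∫ ω, ‖X ω - ∫ ω', X ω' ∂P‖ ^ 2 ∂P

/-- `φhat` is the Fourier transform of `φ`, with the normalization
`φhat(t) = (2π)⁻¹ ∫ e^{-itx} φ(x) dx`, in the sense of tempered distributions: both are functions
that can be paired with Schwartz functions and `∫ φhat g = (2π)⁻¹ ∫ φ(x) (∫ e^{-itx} g(t) dt) dx`
for every Schwartz function `g`. For integrable `φ` this is the classical Fourier integral,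
see `IsFourierTransform.of_integrable`. -/
structure IsFourierTransform (φ φhat : ℝ → ℂ) : Prop where
  integrable_left : ∀ g : 𝓢(ℝ, ℂ), Integrable fun x => φ x * g x
  integrable_right : ∀ g : 𝓢(ℝ, ℂ), Integrable fun t => φhat t * g t
  pairing : ∀ g : 𝓢(ℝ, ℂ), ∫ t, φhat t * g t =
    (2 * Real.pi : ℂ)⁻¹ * ∫ x, φ x * ∫ t : ℝ, Complex.exp (-(Complex.I * t * x)) * g t

/-- A classical Fourier integral is a Fourier transform in the above sense. -/
theorem IsFourierTransform.of_integrable {φ : ℝ → ℂ} (hφ : Integrable φ) :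
    IsFourierTransform φ
      (fun t => (2 * Real.pi : ℂ)⁻¹ * ∫ x : ℝ, Complex.exp (-(Complex.I * t * x)) * φ x) := by
  have hnorm : ∀ t x : ℝ, ‖Complex.exp (-(Complex.I * t * x))‖ = 1 := by
    intro t x
    rw [Complex.norm_exp]
    simp
  have hprod : ∀ g : 𝓢(ℝ, ℂ), Integrable
      (fun p : ℝ × ℝ => Complex.exp (-(Complex.I * p.1 * p.2)) * (g p.1 * φ p.2))
      (volume.prod volume) := by
    intro g
    refine (g.integrable.mul_prod hφ).bdd_mul (c := 1) ?_ ?_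
    · exact (by fun_prop : Continuous
        fun p : ℝ × ℝ => Complex.exp (-(Complex.I * p.1 * p.2))).aestronglyMeasurable
    · exact Filter.Eventually.of_forall fun p => (hnorm p.1 p.2).le
  have heq : ∀ (g : 𝓢(ℝ, ℂ)) (t : ℝ),
      ((2 * Real.pi : ℂ)⁻¹ * ∫ x : ℝ, Complex.exp (-(Complex.I * t * x)) * φ x) * g t =
      (2 * Real.pi : ℂ)⁻¹ * ∫ x : ℝ, Complex.exp (-(Complex.I * t * x)) * (g t * φ x) := by
    intro g t
    rw [mul_assoc, ← integral_mul_const]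
    congr 2
    ext x
    ring
  refine ⟨fun g => ?_, fun g => ?_, fun g => ?_⟩
  · obtain ⟨c, hc⟩ : ∃ c, ∀ x, ‖g x‖ ≤ c := by
      obtain ⟨c, _, hc⟩ := g.decay 0 0
      exact ⟨c, fun x => by simpa using hc x⟩
    exact hφ.mul_bdd (c := c) g.continuous.aestronglyMeasurable (Filter.Eventually.of_forall hc)
  · simp_rw [heq g]
    exact (hprod g).integral_prod_left.const_mul _
  · simp_rw [heq g]
    rw [integral_const_mul, integral_integral_swap (hprod g)]
    congr 2
    ext x
    rw [← integral_const_mul]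
    congr 1
    ext t
    ring

/-! Everything reduces to `Var U_jj(t) ≤ C (1 + |t|)^6 / n`. By Fourier inversion `φ_jj(M)` is the
superposition `∫ φhat(t) U_jj(t) dt`, and Cauchy–Schwarz with weight `(1 + |t|)^3` turns the bound
on each `U_jj(t)` into the bound on `φ_jj(M)` (`complexVar_integral_mul_le`).

The bound on `U_jj(t)` comes from an Efron–Stein inequality: the variance is at most the sum, over
the independent entries, of the mean squared effect of setting that entry to zero. Write `exp(itM) =
exp(iA)` with `A = rW`, `r = t/√n`, and let `B` be `A` with the entries `(a,b)`, `(b,a)` deleted, a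
change of size `δ = |r W_ab|`. Duhamel's formula, used twice, bounds the effect by `2δ · overlap_B +
2δ² · rowMass_B` (`DiffersAt.norm_sub_diag_le`). Both coefficients involve only `B`, which is
independent of `W_ab`, so expectations factor and only second and fourth moments of the entries
enter.

Summation over `(a,b)` needs one matrix common to all positions, so the coefficients are carried
back from `B` to `A`, again by Duhamel. Unitarity then gives `∑ overlap² ≤ 1` and `∑ rowMass² ≤ 4n`.
The contributions have sizes `r²`, `r⁴n` and `r⁶n²`, that is `t²/n`, `t⁴/n` and `t⁶/n`: this is the
origin of both the rate `1/n` and the sixth power. -/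

section Duhamel

/-! ### Unitarity, Duhamel's formula, and the two quantities that control a perturbation. -/

variable {n : ℕ}

/-- The anti-Hermitian generator `iA` of `unitaryExp A`. -/
noncomputable def generator (A : Matrix (Fin n) (Fin n) ℝ) : Matrix (Fin n) (Fin n) ℂ :=
  Complex.I • A.map Complex.ofReal

theorem unitaryExp_eq (A : Matrix (Fin n) (Fin n) ℝ) (t : ℝ) :
    unitaryExp A t = NormedSpace.exp (t • generator A) := by
  rw [unitaryExp, generator, mul_comm, mul_smul]
  rfl

theorem unitaryExp_smul (A : Matrix (Fin n) (Fin n) ℝ) (c t : ℝ) :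
    unitaryExp (c • A) t = unitaryExp A (t * c) := by
  rw [unitaryExp, unitaryExp]
  congr 1
  ext a b
  simp
  ring

theorem unitaryExp_zero (A : Matrix (Fin n) (Fin n) ℝ) : unitaryExp A 0 = 1 := by
  simp [unitaryExp]

theorem unitaryExp_isSymm {A : Matrix (Fin n) (Fin n) ℝ} (hA : A.IsSymm) (t : ℝ) :
    (unitaryExp A t).IsSymm := by
  refine Matrix.IsSymm.exp ?_
  rw [Matrix.IsSymm, Matrix.transpose_smul, ← Matrix.transpose_map, hA]

theorem unitaryExp_conjTranspose_mul {A : Matrix (Fin n) (Fin n) ℝ} (hA : A.IsSymm) (t : ℝ) :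
    (unitaryExp A t).conjTranspose * unitaryExp A t = 1 := by
  have h : ((Complex.I * (t : ℂ)) • A.map Complex.ofReal).conjTranspose =
      -((Complex.I * (t : ℂ)) • A.map Complex.ofReal) := by
    ext a b
    have := hA.apply a b
    simp [this]
  rw [unitaryExp, ← Matrix.exp_conjTranspose, h,
    ← Matrix.exp_add_of_commute _ _ (Commute.neg_left
      (Commute.refl ((Complex.I * (t : ℂ)) • A.map Complex.ofReal)))]
  simp

/-- The diagonal of `U* U = 1`. This is what keeps sums over matrix positions small. -/
theorem sum_norm_sq_unitaryExp {A : Matrix (Fin n) (Fin n) ℝ} (hA : A.IsSymm) (t : ℝ)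
    (j : Fin n) : ∑ a, ‖unitaryExp A t a j‖ ^ 2 = 1 := by
  have h := congrFun (congrFun (unitaryExp_conjTranspose_mul hA t) j) j
  rw [Matrix.mul_apply, Matrix.one_apply_eq] at h
  have h2 : ((∑ a, ‖unitaryExp A t a j‖ ^ 2 : ℝ) : ℂ) = 1 := by
    rw [← h]
    push_cast
    refine Finset.sum_congr rfl fun a _ => ?_
    rw [Matrix.conjTranspose_apply, ← Complex.conj_mul']
    rfl
  exact_mod_cast h2

theorem norm_unitaryExp_le {A : Matrix (Fin n) (Fin n) ℝ} (hA : A.IsSymm) (t : ℝ)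
    (a j : Fin n) : ‖unitaryExp A t a j‖ ≤ 1 := by
  have h := Finset.single_le_sum (f := fun a => ‖unitaryExp A t a j‖ ^ 2)
    (fun a _ => by positivity) (Finset.mem_univ a)
  rw [sum_norm_sq_unitaryExp hA] at h
  nlinarith [norm_nonneg (unitaryExp A t a j)]

open scoped Matrix.Norms.Operator in
theorem continuous_unitaryExp :
    Continuous fun p : Matrix (Fin n) (Fin n) ℝ × ℝ => unitaryExp p.1 p.2 := by
  simp_rw [unitaryExp]
  refine (NormedSpace.exp_continuous (𝔸 := Matrix (Fin n) (Fin n) ℂ)).comp ?_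
  refine Continuous.smul (f := fun p : Matrix (Fin n) (Fin n) ℝ × ℝ => Complex.I * (p.2 : ℂ))
    (by fun_prop) ?_
  exact continuous_fst.matrix_map Complex.continuous_ofReal

theorem continuous_unitaryExp_apply (A : Matrix (Fin n) (Fin n) ℝ) (a b : Fin n) :
    Continuous fun t => unitaryExp A t a b :=
  (continuous_unitaryExp.comp (Continuous.prodMk_right A)).matrix_elem a b

open scoped Matrix.Norms.Operator in
/-- Duhamel's formula, entry by entry. -/
theorem unitaryExp_sub_apply (A B : Matrix (Fin n) (Fin n) ℝ) (t : ℝ) (c d : Fin n) :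
    unitaryExp A t c d - unitaryExp B t c d =
      ∫ s in (0 : ℝ)..t, (unitaryExp B (t - s) * generator (A - B) * unitaryExp A s) c d := by
  have hgen : generator (A - B) = generator A - generator B := by
    ext a b
    simp [generator, mul_sub]
  -- The path `exp(i(t-s)B) exp(isA)` runs from `exp(itB)` at `s = 0` to `exp(itA)` at `s = t`.
  have hderiv : ∀ s : ℝ, HasDerivAt (fun s => (unitaryExp B (t - s) * unitaryExp A s) c d)
      ((unitaryExp B (t - s) * generator (A - B) * unitaryExp A s) c d) s := by
    intro s
    have h1 : HasDerivAt (fun s : ℝ => unitaryExp A s) (generator A * unitaryExp A s) s := by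
      simp_rw [unitaryExp_eq]
      exact hasDerivAt_exp_smul_const' (𝔸 := Matrix (Fin n) (Fin n) ℂ) (generator A) s
    have h2 : HasDerivAt (fun s : ℝ => unitaryExp B (t - s))
        (-(unitaryExp B (t - s) * generator B)) s := by
      have h3 : HasDerivAt (fun s : ℝ => unitaryExp B s)
          (unitaryExp B (t - s) * generator B) (t - s) := by
        simp_rw [unitaryExp_eq]
        exact hasDerivAt_exp_smul_const (𝔸 := Matrix (Fin n) (Fin n) ℂ) (generator B) (t - s)
      have h6 := h3.scomp s ((hasDerivAt_id s).const_sub t)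
      rw [neg_smul, one_smul] at h6
      exact h6
    have h4 := h2.mul h1
    have h5 := ((hasDerivAt_pi.1 ((hasDerivAt_pi.1 h4) c)) d)
    have h7 : unitaryExp B (t - s) * generator (A - B) * unitaryExp A s =
        -(unitaryExp B (t - s) * generator B) * unitaryExp A s +
          unitaryExp B (t - s) * (generator A * unitaryExp A s) := by
      rw [hgen]
      noncomm_ring
    rw [h7]
    exact h5
  have hcont : Continuous fun s =>
      (unitaryExp B (t - s) * generator (A - B) * unitaryExp A s) c d := by
    refine Continuous.matrix_elem ?_ c d
    refine ((continuous_unitaryExp.comp (Continuous.prodMk_right B)).comp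
      (continuous_const.sub continuous_id)).mul continuous_const |>.mul
      (continuous_unitaryExp.comp (Continuous.prodMk_right A))
  rw [intervalIntegral.integral_eq_sub_of_hasDerivAt (fun s _ => hderiv s)
    (hcont.intervalIntegrable _ _)]
  simp [unitaryExp_zero]

/-- `A` and `B` differ at most in the entries `(a, b)` and `(b, a)`, by at most `δ`. -/
def DiffersAt (A B : Matrix (Fin n) (Fin n) ℝ) (a b : Fin n) (δ : ℝ) : Prop :=
  ∀ c d, |A c d - B c d| ≤
    δ * ((if c = a ∧ d = b then 1 else 0) + (if c = b ∧ d = a then 1 else 0))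

theorem DiffersAt.symm {A B : Matrix (Fin n) (Fin n) ℝ} {a b : Fin n} {δ : ℝ}
    (h : DiffersAt A B a b δ) : DiffersAt B A a b δ := fun c d => by
  rw [abs_sub_comm]
  exact h c d

/-- Only the positions `(a,b)` and `(b,a)` survive in the double sum. When `a = b` the single
position is counted twice, which is harmless for an upper bound. -/
theorem DiffersAt.norm_mul_mul_le {A B : Matrix (Fin n) (Fin n) ℝ} {a b : Fin n} {δ : ℝ}
    (h : DiffersAt A B a b δ) (X Y : Matrix (Fin n) (Fin n) ℂ) (c d : Fin n) :
    ‖(X * generator (A - B) * Y) c d‖ ≤ δ * (‖X c a‖ * ‖Y b d‖ + ‖X c b‖ * ‖Y a d‖) := by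
  rw [Matrix.mul_assoc, Matrix.mul_apply]
  simp_rw [Matrix.mul_apply, Finset.mul_sum]
  calc ‖∑ k, ∑ l, X c k * (generator (A - B) k l * Y l d)‖
      ≤ ∑ k, ∑ l, ‖X c k * (generator (A - B) k l * Y l d)‖ :=
        (norm_sum_le _ _).trans (Finset.sum_le_sum fun k _ => norm_sum_le _ _)
    _ ≤ ∑ k, ∑ l, ‖X c k‖ * ((δ * ((if k = a ∧ l = b then 1 else 0) +
          (if k = b ∧ l = a then 1 else 0))) * ‖Y l d‖) := by
        gcongr with k _ l _
        rw [norm_mul, norm_mul]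
        gcongr
        refine le_trans (le_of_eq ?_) (h k l)
        simp only [generator, Matrix.smul_apply, Matrix.map_apply, smul_eq_mul, norm_mul,
          Complex.norm_I, one_mul, Complex.norm_real, Matrix.sub_apply, Real.norm_eq_abs]
    _ = δ * (‖X c a‖ * ‖Y b d‖ + ‖X c b‖ * ‖Y a d‖) := by
        simp only [mul_add, add_mul, Finset.sum_add_distrib, ite_and, mul_ite, mul_one, mul_zero,
          ite_mul, zero_mul, Finset.sum_ite_eq', Finset.mem_univ, if_true, Finset.sum_ite_irrel,
          Finset.sum_const_zero]
        ring

/-- The mass of rows `a` and `b` of the `j`-th column of `exp (isA)`, averaged over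
`s ∈ [0, 1]`. -/
noncomputable def rowMass (A : Matrix (Fin n) (Fin n) ℝ) (j a b : Fin n) : ℝ :=
  ∫ s in (0 : ℝ)..1, (‖unitaryExp A s a j‖ + ‖unitaryExp A s b j‖)

/-- The convolution at time `1` of the moduli of the entries `(a, j)` and `(b, j)` of
`exp (isA)`. -/
noncomputable def overlap (A : Matrix (Fin n) (Fin n) ℝ) (j a b : Fin n) : ℝ :=
  ∫ s in (0 : ℝ)..1, ‖unitaryExp A (1 - s) a j‖ * ‖unitaryExp A s b j‖

theorem sq_integral_le_integral_sq {f : ℝ → ℝ} (hf : Continuous f) :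
    (∫ s in (0 : ℝ)..1, f s) ^ 2 ≤ ∫ s in (0 : ℝ)..1, f s ^ 2 := by
  set c := ∫ s in (0 : ℝ)..1, f s with hc
  have h0 : 0 ≤ ∫ s in (0 : ℝ)..1, (f s - c) ^ 2 :=
    intervalIntegral.integral_nonneg zero_le_one fun s _ => sq_nonneg _
  have h1 : ∫ s in (0 : ℝ)..1, (f s - c) ^ 2 =
      (∫ s in (0 : ℝ)..1, f s ^ 2) - 2 * c * c + c ^ 2 := by
    have h2 : ∀ s, (f s - c) ^ 2 = f s ^ 2 - 2 * c * f s + c ^ 2 := fun s => by ring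
    simp_rw [h2]
    rw [intervalIntegral.integral_add, intervalIntegral.integral_sub,
      intervalIntegral.integral_const_mul, ← hc]
    · simp
    all_goals exact Continuous.intervalIntegrable (by fun_prop) _ _
  nlinarith

theorem continuous_norm_unitaryExp_apply (A : Matrix (Fin n) (Fin n) ℝ) (a b : Fin n) :
    Continuous fun t => ‖unitaryExp A t a b‖ :=
  (continuous_unitaryExp_apply A a b).norm

theorem continuous_norm_unitaryExp_apply_reflect (A : Matrix (Fin n) (Fin n) ℝ) (a b : Fin n) :
    Continuous fun t => ‖unitaryExp A (1 - t) a b‖ :=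
  (continuous_norm_unitaryExp_apply A a b).comp (continuous_const.sub continuous_id)

theorem rowMass_nonneg (A : Matrix (Fin n) (Fin n) ℝ) (j a b : Fin n) : 0 ≤ rowMass A j a b :=
  intervalIntegral.integral_nonneg zero_le_one fun s _ => by positivity

theorem overlap_nonneg (A : Matrix (Fin n) (Fin n) ℝ) (j a b : Fin n) : 0 ≤ overlap A j a b :=
  intervalIntegral.integral_nonneg zero_le_one fun s _ => by positivity

theorem rowMass_le {A : Matrix (Fin n) (Fin n) ℝ} (hA : A.IsSymm) (j a b : Fin n) :
    rowMass A j a b ≤ 2 := by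
  have ha := continuous_norm_unitaryExp_apply A a j
  have hb := continuous_norm_unitaryExp_apply A b j
  calc rowMass A j a b ≤ ∫ s in (0 : ℝ)..1, (1 + 1 : ℝ) :=
        intervalIntegral.integral_mono_on zero_le_one ((ha.add hb).intervalIntegrable _ _)
          (by simp) fun s _ => add_le_add (norm_unitaryExp_le hA _ _ _) (norm_unitaryExp_le hA _ _ _)
    _ = 2 := by norm_num

theorem overlap_le {A : Matrix (Fin n) (Fin n) ℝ} (hA : A.IsSymm) (j a b : Fin n) :
    overlap A j a b ≤ 1 := by
  have ha := continuous_norm_unitaryExp_apply_reflect A a j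
  have hb := continuous_norm_unitaryExp_apply A b j
  calc overlap A j a b ≤ ∫ s in (0 : ℝ)..1, (1 : ℝ) :=
        intervalIntegral.integral_mono_on zero_le_one ((ha.mul hb).intervalIntegrable _ _)
          (by simp) fun s _ => mul_le_one₀ (norm_unitaryExp_le hA _ _ _) (norm_nonneg _)
            (norm_unitaryExp_le hA _ _ _)
    _ = 1 := by norm_num

/-- Reflection `s ↦ 1 - s`. It identifies the two cross terms produced by Duhamel's formula. -/
theorem overlap_comm (A : Matrix (Fin n) (Fin n) ℝ) (j a b : Fin n) :
    overlap A j a b = overlap A j b a := by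
  have h := intervalIntegral.integral_comp_sub_left
    (fun s => ‖unitaryExp A (1 - s) b j‖ * ‖unitaryExp A s a j‖) (a := 0) (b := 1) 1
  rw [sub_self, sub_zero] at h
  rw [overlap, overlap, ← h]
  congr 1
  ext s
  rw [sub_sub_cancel, mul_comm]

theorem integral_reflect_eq_rowMass (A : Matrix (Fin n) (Fin n) ℝ) (j a b : Fin n) :
    ∫ s in (0 : ℝ)..1, (‖unitaryExp A (1 - s) a j‖ + ‖unitaryExp A (1 - s) b j‖) =
      rowMass A j a b := by
  have h := intervalIntegral.integral_comp_sub_left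
    (fun s => ‖unitaryExp A s a j‖ + ‖unitaryExp A s b j‖) (a := 0) (b := 1) 1
  rwa [sub_self, sub_zero] at h

/-- After Jensen in `s`, the double sum factors at each time into the squared norms of two unit
columns. -/
theorem sum_overlap_sq_le {A : Matrix (Fin n) (Fin n) ℝ} (hA : A.IsSymm) (j : Fin n) :
    ∑ a, ∑ b, overlap A j a b ^ 2 ≤ 1 := by
  have hcont : ∀ a b, Continuous fun s : ℝ => ‖unitaryExp A (1 - s) a j‖ * ‖unitaryExp A s b j‖ :=
    fun a b => (continuous_norm_unitaryExp_apply_reflect A a j).mul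
      (continuous_norm_unitaryExp_apply A b j)
  calc ∑ a, ∑ b, overlap A j a b ^ 2
      ≤ ∑ a, ∑ b, ∫ s in (0 : ℝ)..1, (‖unitaryExp A (1 - s) a j‖ * ‖unitaryExp A s b j‖) ^ 2 := by
        gcongr with a _ b _
        exact sq_integral_le_integral_sq (hcont a b)
    _ = ∫ s in (0 : ℝ)..1,
          ∑ a, ∑ b, (‖unitaryExp A (1 - s) a j‖ * ‖unitaryExp A s b j‖) ^ 2 := by
        rw [intervalIntegral.integral_finsetSum]
        · refine Finset.sum_congr rfl fun a _ => ?_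
          rw [intervalIntegral.integral_finsetSum]
          exact fun b _ => ((hcont a b).pow 2).intervalIntegrable _ _
        · exact fun a _ => (continuous_finsetSum _ fun b _ =>
            (hcont a b).pow 2).intervalIntegrable _ _
    _ = ∫ s in (0 : ℝ)..1, (1 : ℝ) := by
        congr 1
        ext s
        simp_rw [mul_pow, ← Finset.mul_sum, sum_norm_sq_unitaryExp hA, mul_one]
        exact sum_norm_sq_unitaryExp hA _ _
    _ ≤ 1 := by simp

/-- By `(x + y)² ≤ 2(x² + y²)` each of the two terms involves a single index: that index sums to
one, the idle index contributes `n`. -/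
theorem sum_rowMass_sq_le {A : Matrix (Fin n) (Fin n) ℝ} (hA : A.IsSymm) (j : Fin n) :
    ∑ a, ∑ b, rowMass A j a b ^ 2 ≤ 4 * n := by
  have hcont : ∀ a b, Continuous fun s : ℝ => ‖unitaryExp A s a j‖ + ‖unitaryExp A s b j‖ :=
    fun a b => (continuous_norm_unitaryExp_apply A a j).add
      (continuous_norm_unitaryExp_apply A b j)
  have hsq : ∀ a, Continuous fun s : ℝ => ‖unitaryExp A s a j‖ ^ 2 :=
    fun a => (continuous_norm_unitaryExp_apply A a j).pow 2
  have hcont2 : ∀ a b, Continuous fun s : ℝ =>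
      2 * (‖unitaryExp A s a j‖ ^ 2 + ‖unitaryExp A s b j‖ ^ 2) :=
    fun a b => continuous_const.mul ((hsq a).add (hsq b))
  calc ∑ a, ∑ b, rowMass A j a b ^ 2
      ≤ ∑ a, ∑ b, ∫ s in (0 : ℝ)..1,
          2 * (‖unitaryExp A s a j‖ ^ 2 + ‖unitaryExp A s b j‖ ^ 2) := by
        gcongr with a _ b _
        refine (sq_integral_le_integral_sq (hcont a b)).trans ?_
        exact intervalIntegral.integral_mono_on zero_le_one
          (((hcont a b).pow 2).intervalIntegrable _ _) ((hcont2 a b).intervalIntegrable _ _)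
          fun s _ => add_sq_le
    _ = ∫ s in (0 : ℝ)..1,
          ∑ a, ∑ b, 2 * (‖unitaryExp A s a j‖ ^ 2 + ‖unitaryExp A s b j‖ ^ 2) := by
        rw [intervalIntegral.integral_finsetSum]
        · refine Finset.sum_congr rfl fun a _ => ?_
          rw [intervalIntegral.integral_finsetSum]
          exact fun b _ => (hcont2 a b).intervalIntegrable _ _
        · exact fun a _ => (continuous_finsetSum _ fun b _ =>
            hcont2 a b).intervalIntegrable _ _
    _ = ∫ s in (0 : ℝ)..1, (4 * n : ℝ) := by
        congr 1
        ext s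
        simp_rw [← Finset.mul_sum, Finset.sum_add_distrib, sum_norm_sq_unitaryExp hA]
        simp only [Finset.sum_const, Finset.card_univ, Fintype.card_fin, nsmul_eq_mul,
          ← Finset.mul_sum, sum_norm_sq_unitaryExp hA]
        ring
    _ ≤ 4 * n := by simp

/-! ### Comparison of `exp(isA)` and `exp(isB)` when one symmetric pair of entries differs. -/

section Perturbation

variable {A B : Matrix (Fin n) (Fin n) ℝ} {a b : Fin n} {δ : ℝ}

theorem DiffersAt.norm_sub_apply_le (h : DiffersAt A B a b δ) (hδ : 0 ≤ δ) (hB : B.IsSymm)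
    (c j : Fin n) {s : ℝ} (hs : s ∈ Set.Icc (0 : ℝ) 1) :
    ‖unitaryExp A s c j - unitaryExp B s c j‖ ≤ δ * rowMass A j a b := by
  have hcont : Continuous fun s : ℝ => ‖unitaryExp A s a j‖ + ‖unitaryExp A s b j‖ :=
    (continuous_norm_unitaryExp_apply A a j).add (continuous_norm_unitaryExp_apply A b j)
  rw [unitaryExp_sub_apply]
  calc ‖∫ r in (0 : ℝ)..s, (unitaryExp B (s - r) * generator (A - B) * unitaryExp A r) c j‖
      ≤ ∫ r in (0 : ℝ)..s, δ * (‖unitaryExp A r a j‖ + ‖unitaryExp A r b j‖) := by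
        refine intervalIntegral.norm_integral_le_of_norm_le hs.1
          (Filter.Eventually.of_forall fun r _ => ?_)
          ((continuous_const.mul hcont).intervalIntegrable _ _)
        refine (h.norm_mul_mul_le _ _ _ _).trans ?_
        refine mul_le_mul_of_nonneg_left ?_ hδ
        -- Bounding the left factor by one makes the estimate uniform in the row `c`.
        have ha := mul_le_of_le_one_left (norm_nonneg (unitaryExp A r a j))
          (norm_unitaryExp_le hB (s - r) c b)
        have hb := mul_le_of_le_one_left (norm_nonneg (unitaryExp A r b j))
          (norm_unitaryExp_le hB (s - r) c a)
        linarith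
    _ ≤ ∫ r in (0 : ℝ)..1, δ * (‖unitaryExp A r a j‖ + ‖unitaryExp A r b j‖) :=
        intervalIntegral.integral_mono_interval le_rfl hs.1 hs.2
          (Filter.Eventually.of_forall fun r => by positivity)
          ((continuous_const.mul hcont).intervalIntegrable _ _)
    _ = δ * rowMass A j a b := intervalIntegral.integral_const_mul _ _

theorem DiffersAt.norm_apply_le (h : DiffersAt A B a b δ) (hδ : 0 ≤ δ) (hB : B.IsSymm)
    (c j : Fin n) {s : ℝ} (hs : s ∈ Set.Icc (0 : ℝ) 1) :
    ‖unitaryExp A s c j‖ ≤ ‖unitaryExp B s c j‖ + δ * rowMass A j a b := by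
  have h1 := h.norm_sub_apply_le hδ hB c j hs
  have h2 := norm_le_norm_add_norm_sub (unitaryExp B s c j) (unitaryExp A s c j)
  rw [norm_sub_rev] at h2
  linarith

theorem DiffersAt.norm_apply_le' (h : DiffersAt A B a b δ) (hδ : 0 ≤ δ) (hA : A.IsSymm)
    (c j : Fin n) {s : ℝ} (hs : s ∈ Set.Icc (0 : ℝ) 1) :
    ‖unitaryExp B s c j‖ ≤ ‖unitaryExp A s c j‖ + δ * rowMass B j a b :=
  h.symm.norm_apply_le hδ hA c j hs

/-- Each of the two moduli moves by at most `δ * rowMass A ≤ 2δ`. This crude error is affordable,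
since it only enters multiplied by `r⁴`. -/
theorem DiffersAt.rowMass_le (h : DiffersAt A B a b δ) (hδ : 0 ≤ δ) (hA : A.IsSymm)
    (hB : B.IsSymm) (j : Fin n) : rowMass A j a b ≤ rowMass B j a b + 4 * δ := by
  have hcA : Continuous fun s : ℝ => ‖unitaryExp A s a j‖ + ‖unitaryExp A s b j‖ :=
    (continuous_norm_unitaryExp_apply A a j).add (continuous_norm_unitaryExp_apply A b j)
  have hcB : Continuous fun s : ℝ => ‖unitaryExp B s a j‖ + ‖unitaryExp B s b j‖ :=
    (continuous_norm_unitaryExp_apply B a j).add (continuous_norm_unitaryExp_apply B b j)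
  have h2 := _root_.rowMass_le hA j a b
  calc rowMass A j a b
      ≤ ∫ s in (0 : ℝ)..1, ((‖unitaryExp B s a j‖ + ‖unitaryExp B s b j‖) + 4 * δ) := by
        refine intervalIntegral.integral_mono_on zero_le_one (hcA.intervalIntegrable _ _)
          ((hcB.add continuous_const).intervalIntegrable _ _) fun s hs => ?_
        have ha := h.norm_apply_le hδ hB a j hs
        have hb := h.norm_apply_le hδ hB b j hs
        nlinarith
    _ = rowMass B j a b + 4 * δ := by
        rw [intervalIntegral.integral_add (hcB.intervalIntegrable _ _) (by simp), rowMass]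
        simp

/-- The two factors are exchanged one at a time. The error has to keep the factor `rowMass`: a bare
multiple of `δ` would contribute order `t⁴` after summing over about `n²` positions, with no decay
in `n`. -/
theorem DiffersAt.overlap_le (h : DiffersAt A B a b δ) (hδ : 0 ≤ δ) (hA : A.IsSymm)
    (hB : B.IsSymm) (j : Fin n) :
    overlap B j a b ≤ overlap A j a b + 4 * δ * rowMass B j a b := by
  have hcB : Continuous fun s : ℝ => ‖unitaryExp B (1 - s) a j‖ * ‖unitaryExp B s b j‖ :=
    (continuous_norm_unitaryExp_apply_reflect B a j).mul (continuous_norm_unitaryExp_apply B b j)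
  have hcA : Continuous fun s : ℝ => ‖unitaryExp A (1 - s) a j‖ * ‖unitaryExp A s b j‖ :=
    (continuous_norm_unitaryExp_apply_reflect A a j).mul (continuous_norm_unitaryExp_apply A b j)
  have h0 := rowMass_nonneg B j a b
  calc overlap B j a b
      ≤ ∫ s in (0 : ℝ)..1, (‖unitaryExp A (1 - s) a j‖ * ‖unitaryExp A s b j‖ +
          4 * δ * rowMass B j a b) := by
        refine intervalIntegral.integral_mono_on zero_le_one (hcB.intervalIntegrable _ _)
          ((hcA.add continuous_const).intervalIntegrable _ _) fun s hs => ?_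
        have hs' : 1 - s ∈ Set.Icc (0 : ℝ) 1 := ⟨by linarith [hs.2], by linarith [hs.1]⟩
        have ha := h.norm_apply_le' hδ hA a j hs'
        have hb := h.norm_apply_le' hδ hA b j hs
        have h1 := norm_unitaryExp_le hB (1 - s) a j
        have h2 := norm_unitaryExp_le hA s b j
        have h3 := norm_nonneg (unitaryExp B (1 - s) a j)
        have h4 := norm_nonneg (unitaryExp A s b j)
        have h5 : 0 ≤ δ * rowMass B j a b := by positivity
        have h6 := mul_le_mul_of_nonneg_left hb h3
        have h7 := mul_le_mul_of_nonneg_right ha h4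
        nlinarith
    _ = overlap A j a b + 4 * δ * rowMass B j a b := by
        rw [intervalIntegral.integral_add (hcA.intervalIntegrable _ _) (by simp), overlap]
        simp

/-- Second-order expansion of the diagonal entry of `exp (iA)` around `B`. -/
theorem DiffersAt.norm_sub_diag_le (h : DiffersAt A B a b δ) (hδ : 0 ≤ δ) (hA : A.IsSymm)
    (hB : B.IsSymm) (j : Fin n) :
    ‖unitaryExp A 1 j j - unitaryExp B 1 j j‖ ≤
      2 * δ * overlap B j a b + 2 * δ ^ 2 * rowMass B j a b := by
  have hc1 : Continuous fun s : ℝ => ‖unitaryExp B (1 - s) a j‖ * ‖unitaryExp B s b j‖ :=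
    (continuous_norm_unitaryExp_apply_reflect B a j).mul (continuous_norm_unitaryExp_apply B b j)
  have hc2 : Continuous fun s : ℝ => ‖unitaryExp B (1 - s) b j‖ * ‖unitaryExp B s a j‖ :=
    (continuous_norm_unitaryExp_apply_reflect B b j).mul (continuous_norm_unitaryExp_apply B a j)
  have hc3 : Continuous fun s : ℝ => ‖unitaryExp B (1 - s) a j‖ + ‖unitaryExp B (1 - s) b j‖ :=
    (continuous_norm_unitaryExp_apply_reflect B a j).add
      (continuous_norm_unitaryExp_apply_reflect B b j)
  have hY := _root_.rowMass_le hA j a b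
  have hY0 := rowMass_nonneg A j a b
  have hB0 := rowMass_nonneg B j a b
  rw [unitaryExp_sub_apply]
  calc ‖∫ s in (0 : ℝ)..1, (unitaryExp B (1 - s) * generator (A - B) * unitaryExp A s) j j‖
      ≤ ∫ s in (0 : ℝ)..1, δ * ((‖unitaryExp B (1 - s) a j‖ * ‖unitaryExp B s b j‖ +
          ‖unitaryExp B (1 - s) b j‖ * ‖unitaryExp B s a j‖) + δ * rowMass A j a b *
          (‖unitaryExp B (1 - s) a j‖ + ‖unitaryExp B (1 - s) b j‖)) := by
        refine intervalIntegral.norm_integral_le_of_norm_le zero_le_one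
          (Filter.Eventually.of_forall fun s hs => ?_)
          ((continuous_const.mul ((hc1.add hc2).add
            (continuous_const.mul hc3))).intervalIntegrable _ _)
        refine (h.norm_mul_mul_le _ _ _ _).trans ?_
        have hs' : s ∈ Set.Icc (0 : ℝ) 1 := Set.Ioc_subset_Icc_self hs
        have ha := mul_le_mul_of_nonneg_left (h.norm_apply_le hδ hB a j hs')
          (norm_nonneg (unitaryExp B (1 - s) b j))
        have hb := mul_le_mul_of_nonneg_left (h.norm_apply_le hδ hB b j hs')
          (norm_nonneg (unitaryExp B (1 - s) a j))
        -- Duhamel produces entries of row `j` on the left; symmetry of `exp(isB)` turns them into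
        -- entries of column `j`, as in `overlap`.
        rw [(unitaryExp_isSymm hB _).apply a j, (unitaryExp_isSymm hB _).apply b j]
        refine mul_le_mul_of_nonneg_left ?_ hδ
        linarith
    _ = δ * ((overlap B j a b + overlap B j b a) +
          δ * rowMass A j a b * rowMass B j a b) := by
        have hi : IntervalIntegrable (fun s : ℝ =>
            ‖unitaryExp B (1 - s) a j‖ * ‖unitaryExp B s b j‖ +
              ‖unitaryExp B (1 - s) b j‖ * ‖unitaryExp B s a j‖) volume 0 1 :=
          (hc1.add hc2).intervalIntegrable 0 1
        have hi3 := (hc3.const_mul (δ * rowMass A j a b)).intervalIntegrable 0 1 (μ := volume)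
        rw [intervalIntegral.integral_const_mul, intervalIntegral.integral_add hi hi3,
          intervalIntegral.integral_add (hc1.intervalIntegrable _ _) (hc2.intervalIntegrable _ _),
          intervalIntegral.integral_const_mul, integral_reflect_eq_rowMass]
        rfl
    _ ≤ 2 * δ * overlap B j a b + 2 * δ ^ 2 * rowMass B j a b := by
        rw [overlap_comm B j b a]
        -- Only the factor depending on `A` is bounded trivially, so that what remains beside `δ`
        -- depends on `B` alone.
        have : δ ^ 2 * rowMass B j a b * rowMass A j a b ≤ δ ^ 2 * rowMass B j a b * 2 := by
          gcongr
        nlinarith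

end Perturbation

end Duhamel

/-! ### Efron–Stein inequality with deletion of a coordinate. -/

section EfronStein

theorem memLp_of_abs_le {α : Type*} [MeasurableSpace α] {μ : Measure α} [IsFiniteMeasure μ]
    {f : α → ℝ} (hf : Measurable f) {K : ℝ} (hK : ∀ x, |f x| ≤ K) (p : ENNReal) :
    MemLp f p μ :=
  MemLp.of_bound hf.aestronglyMeasurable K (Filter.Eventually.of_forall hK)

theorem variance_le_integral_sub_sq {α : Type*} [MeasurableSpace α] {μ : Measure α}
    [IsProbabilityMeasure μ] {f : α → ℝ} (hf : Measurable f) (c : ℝ) :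
    Var[f; μ] ≤ ∫ x, (f x - c) ^ 2 ∂μ := by
  rw [← variance_sub_const hf.aestronglyMeasurable c]
  exact variance_le_expectation_sq (hf.sub_const c).aestronglyMeasurable

theorem sq_integral_le {α : Type*} [MeasurableSpace α] {μ : Measure α}
    [IsProbabilityMeasure μ] {f : α → ℝ} (hf : MemLp f 2 μ) :
    (∫ x, f x ∂μ) ^ 2 ≤ ∫ x, f x ^ 2 ∂μ := by
  have h := variance_nonneg f μ
  rw [variance_eq_sub hf] at h
  simpa using h

/-- Law of total variance: what remains beside the mean conditional variance is the variance of
`g(x) = ∫ G(x, y) dν(y)`. It is at most the second moment about the constant `g x₀`, and Jensen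
brings the square inside the integral over `y`. -/
theorem variance_prod_le {α β : Type*} [MeasurableSpace α] [MeasurableSpace β]
    {μ : Measure α} {ν : Measure β} [IsProbabilityMeasure μ] [IsProbabilityMeasure ν]
    {G : α × β → ℝ} (hG : Measurable G) {K : ℝ} (hK : ∀ p, |G p| ≤ K) (x₀ : α) :
    Var[G; μ.prod ν] ≤ ∫ x, Var[fun y => G (x, y); ν] ∂μ +
      ∫ p, (G p - G (x₀, p.2)) ^ 2 ∂(μ.prod ν) := by
  have hGx : ∀ x, Measurable fun y => G (x, y) := fun x => hG.comp measurable_prodMk_left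
  have hG2 : MemLp G 2 (μ.prod ν) := memLp_of_abs_le hG hK 2
  have hGx2 : ∀ x, MemLp (fun y => G (x, y)) 2 ν := fun x =>
    memLp_of_abs_le (hGx x) (fun y => hK _) 2
  have hsq : Integrable (fun p => G p ^ 2) (μ.prod ν) := hG2.integrable_sq
  set g : α → ℝ := fun x => ∫ y, G (x, y) ∂ν with hg
  have hgm : Measurable g := hG.stronglyMeasurable.integral_prod_right'.measurable
  have hgK : ∀ x, |g x| ≤ K := fun x => by
    have := norm_integral_le_of_norm_le_const (μ := ν) (f := fun y => G (x, y))
      (Filter.Eventually.of_forall fun y => hK (x, y))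
    simpa using this
  have hg2 : MemLp g 2 μ := memLp_of_abs_le hgm hgK 2
  have h1 : ∫ x, Var[fun y => G (x, y); ν] ∂μ = ∫ p, G p ^ 2 ∂(μ.prod ν) - ∫ x, g x ^ 2 ∂μ := by
    have h2 : ∀ x, Var[fun y => G (x, y); ν] = ∫ y, G (x, y) ^ 2 ∂ν - g x ^ 2 := fun x => by
      rw [variance_eq_sub (hGx2 x)]
      rfl
    simp_rw [h2]
    rw [integral_sub hsq.integral_prod_left hg2.integrable_sq, integral_prod _ hsq]
  have h3 : Var[G; μ.prod ν] = ∫ p, G p ^ 2 ∂(μ.prod ν) - (∫ x, g x ∂μ) ^ 2 := by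
    rw [variance_eq_sub hG2, integral_prod _ (hG2.integrable one_le_two)]
    rfl
  have h4 : Var[g; μ] = ∫ x, g x ^ 2 ∂μ - (∫ x, g x ∂μ) ^ 2 := variance_eq_sub hg2
  have hD : Measurable fun p : α × β => G p - G (x₀, p.2) :=
    hG.sub (hG.comp (measurable_const.prodMk measurable_snd))
  have hDK : ∀ p : α × β, |G p - G (x₀, p.2)| ≤ K + K := fun p =>
    (abs_sub _ _).trans (add_le_add (hK _) (hK _))
  have hD2 := (memLp_of_abs_le (μ := μ.prod ν) hD hDK 2).integrable_sq
  have h5 : Var[g; μ] ≤ ∫ p, (G p - G (x₀, p.2)) ^ 2 ∂(μ.prod ν) := by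
    refine (variance_le_integral_sub_sq hgm (g x₀)).trans ?_
    rw [integral_prod _ hD2]
    refine integral_mono ?_ hD2.integral_prod_left fun x => ?_
    · exact (memLp_of_abs_le (hgm.sub_const _) (K := K + K)
        (fun x => (abs_sub _ _).trans (add_le_add (hgK _) (hgK _))) 2).integrable_sq
    · have h6 : g x - g x₀ = ∫ y, (G (x, y) - G (x₀, y)) ∂ν :=
        (integral_sub ((hGx2 x).integrable one_le_two) ((hGx2 x₀).integrable one_le_two)).symm
      simp only
      rw [h6]
      exact sq_integral_le ((hGx2 x).sub (hGx2 x₀))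
  linarith

/-- The Efron–Stein inequality for a product of probability measures on the line. -/
theorem variance_pi_le_sum {N : ℕ} (μ : Fin N → Measure ℝ) [∀ i, IsProbabilityMeasure (μ i)]
    {F : (Fin N → ℝ) → ℝ} (hF : Measurable F) {K : ℝ} (hK : ∀ x, |F x| ≤ K) :
    Var[F; Measure.pi μ] ≤
      ∑ i, ∫ x, (F x - F (Function.update x i 0)) ^ 2 ∂(Measure.pi μ) := by
  induction N with
  | zero =>
    have : F = fun _ => F 0 := by
      ext x
      rw [Subsingleton.elim x 0]
    rw [this, variance_eq_integral aemeasurable_const]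
    simp
  | succ N ih =>
    -- The first coordinate is split off with reference point `0`; the induction hypothesis handles
    -- the others with the first one frozen.
    set ν := Measure.pi fun i => μ (Fin.succ i) with hν
    have hmp : MeasurePreserving (fun p : ℝ × (Fin N → ℝ) => (Fin.cons p.1 p.2 : Fin (N + 1) → ℝ))
        ((μ 0).prod ν) (Measure.pi μ) := by
      have h := (measurePreserving_piFinSuccAbove μ 0).symm
      have h1 : (fun p : ℝ × (Fin N → ℝ) => (Fin.cons p.1 p.2 : Fin (N + 1) → ℝ)) =
          (MeasurableEquiv.piFinSuccAbove (fun _ => ℝ) 0).symm := by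
        ext1 p
        exact (Fin.insertNth_zero' p.1 p.2).symm
      rw [h1]
      exact h
    have hcons : Measurable fun p : ℝ × (Fin N → ℝ) => (Fin.cons p.1 p.2 : Fin (N + 1) → ℝ) :=
      hmp.measurable
    have hG : Measurable fun p : ℝ × (Fin N → ℝ) => F (Fin.cons p.1 p.2) := hF.comp hcons
    have htr : ∀ H : (Fin (N + 1) → ℝ) → ℝ, Measurable H →
        ∫ x, H x ∂(Measure.pi μ) = ∫ p, H (Fin.cons p.1 p.2) ∂((μ 0).prod ν) := fun H hH => by
      rw [← hmp.map_eq, integral_map hcons.aemeasurable hH.aestronglyMeasurable]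
    have hvar : Var[F; Measure.pi μ] =
        Var[fun p : ℝ × (Fin N → ℝ) => F (Fin.cons p.1 p.2); (μ 0).prod ν] := by
      rw [← hmp.map_eq, variance_map hF.aemeasurable hcons.aemeasurable]
      rfl
    have hupd : ∀ i : Fin (N + 1), Measurable fun x : Fin (N + 1) → ℝ =>
        (F x - F (Function.update x i 0)) ^ 2 := fun i =>
      (hF.sub (hF.comp measurable_update_left)).pow_const 2
    rw [hvar, Fin.sum_univ_succ]
    refine (variance_prod_le hG (fun p => hK _) 0).trans ?_
    rw [add_comm]
    refine add_le_add (le_of_eq ?_) ?_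
    · rw [htr _ (hupd 0)]
      simp [Fin.update_cons_zero]
    · have hint : ∀ i : Fin N, Integrable (fun p : ℝ × (Fin N → ℝ) =>
          (F (Fin.cons p.1 p.2) - F (Fin.cons p.1 (Function.update p.2 i 0))) ^ 2)
          ((μ 0).prod ν) := fun i => by
        have hm : Measurable fun p : ℝ × (Fin N → ℝ) =>
            F (Fin.cons p.1 p.2) - F (Fin.cons p.1 (Function.update p.2 i 0)) :=
          hG.sub (hG.comp (measurable_fst.prodMk (measurable_update_left.comp measurable_snd)))
        exact (memLp_of_abs_le hm (K := K + K)
          (fun p => (abs_sub _ _).trans (add_le_add (hK _) (hK _))) 2).integrable_sq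
      calc ∫ x, Var[fun y => F (Fin.cons x y); ν] ∂(μ 0)
          ≤ ∫ x, ∑ i, ∫ y, (F (Fin.cons x y) - F (Fin.cons x (Function.update y i 0))) ^ 2 ∂ν
              ∂(μ 0) := by
            refine integral_mono_of_nonneg (Filter.Eventually.of_forall fun x =>
              variance_nonneg _ _) (integrable_finsetSum _ fun i _ =>
              (hint i).integral_prod_left) (Filter.Eventually.of_forall fun x => ?_)
            exact ih (fun i => μ i.succ) (hG.comp measurable_prodMk_left) (fun y => hK _)
        _ = ∑ i : Fin N, ∫ x, (F x - F (Function.update x i.succ 0)) ^ 2 ∂(Measure.pi μ) := by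
            rw [integral_finsetSum _ fun i _ => (hint i).integral_prod_left]
            refine Finset.sum_congr rfl fun i _ => ?_
            rw [htr _ (hupd i.succ)]
            simp_rw [← Fin.cons_update]
            rw [integral_prod _ (hint i)]

/-- The Efron–Stein inequality for a real function of independent real variables. -/
theorem variance_comp_le_sum {Ω ι : Type*} [Fintype ι] [DecidableEq ι] [MeasurableSpace Ω]
    {P : Measure Ω} [IsProbabilityMeasure P] {X : ι → Ω → ℝ} (hX : ∀ i, Measurable (X i))
    (hind : iIndepFun X P) {F : (ι → ℝ) → ℝ} (hF : Measurable F) {K : ℝ}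
    (hK : ∀ x, |F x| ≤ K) :
    Var[fun ω => F (fun i => X i ω); P] ≤
      ∑ i, ∫ ω, (F (fun k => X k ω) - F (Function.update (fun k => X k ω) i 0)) ^ 2 ∂P := by
  set e := Fintype.equivFin ι
  set Y : Fin (Fintype.card ι) → Ω → ℝ := fun k => X (e.symm k) with hY
  have hYm : Measurable fun ω k => Y k ω := measurable_pi_lambda _ fun k => hX _
  have hmap := (iIndepFun_iff_map_fun_eq_pi_map (fun k => (hX (e.symm k)).aemeasurable)).1
    (hind.precomp e.symm.injective)
  have : ∀ k, IsProbabilityMeasure (P.map (Y k)) := fun k =>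
    Measure.isProbabilityMeasure_map (hX _).aemeasurable
  set G : (Fin (Fintype.card ι) → ℝ) → ℝ := fun y => F fun i => y (e i) with hGdef
  have hG : Measurable G := hF.comp (measurable_pi_lambda _ fun i => measurable_pi_apply _)
  have h := variance_pi_le_sum (fun k => P.map (Y k)) hG (fun x => hK _)
  rw [← hmap] at h
  rw [variance_map hG.aemeasurable hYm.aemeasurable] at h
  have hGY : ∀ ω, G (fun k => Y k ω) = F (fun i => X i ω) := fun ω => by simp [hGdef, hY]
  refine le_trans (le_of_eq ?_) (h.trans (le_of_eq ?_))
  · congr 1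
    ext ω
    exact (hGY ω).symm
  · rw [← e.sum_comp]
    refine Finset.sum_congr rfl fun i _ => ?_
    have hm : Measurable fun x => (G x - G (Function.update x (e i) 0)) ^ 2 :=
      (hG.sub (hG.comp measurable_update_left)).pow_const 2
    refine (integral_map hYm.aemeasurable hm.aestronglyMeasurable).trans ?_
    congr 1
    ext ω
    have h1 : G (Function.update (fun k => Y k ω) (e i) 0) =
        F (Function.update (fun k => X k ω) i 0) := by
      simp only [hGdef]
      congr 1
      ext k
      by_cases hk : k = i
      · subst hk; simp
      · simp [Function.update_of_ne, hk, hY]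
    change (G (fun k => Y k ω) - _) ^ 2 = _
    rw [hGY, h1]

/-- The Efron–Stein inequality for a complex function of independent real variables. -/
theorem complexVar_comp_le_sum {Ω ι : Type*} [Fintype ι] [DecidableEq ι] [MeasurableSpace Ω]
    {P : Measure Ω} [IsProbabilityMeasure P] {X : ι → Ω → ℝ} (hX : ∀ i, Measurable (X i))
    (hind : iIndepFun X P) {F : (ι → ℝ) → ℂ} (hF : Measurable F) {K : ℝ}
    (hK : ∀ x, ‖F x‖ ≤ K) :
    complexVar P (fun ω => F (fun i => X i ω)) ≤
      ∑ i, ∫ ω, ‖F (fun k => X k ω) - F (Function.update (fun k => X k ω) i 0)‖ ^ 2 ∂P := by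
  have hXm : Measurable fun ω k => X k ω := measurable_pi_lambda _ hX
  have hre : Measurable fun x => (F x).re := Complex.measurable_re.comp hF
  have him : Measurable fun x => (F x).im := Complex.measurable_im.comp hF
  have hreK : ∀ x, |(F x).re| ≤ K := fun x => (Complex.abs_re_le_norm _).trans (hK x)
  have himK : ∀ x, |(F x).im| ≤ K := fun x => (Complex.abs_im_le_norm _).trans (hK x)
  have hFX : Integrable (fun ω => F (fun i => X i ω)) P :=
    Integrable.of_bound (hF.comp hXm).aestronglyMeasurable K
      (Filter.Eventually.of_forall fun ω => hK _)
  have hsq : ∀ z : ℂ, ‖z‖ ^ 2 = z.re ^ 2 + z.im ^ 2 := fun z => by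
    rw [Complex.sq_norm, Complex.normSq_apply]
    ring
  have hint : ∀ (g : Ω → ℝ) (L : ℝ), Measurable g → (∀ ω, |g ω| ≤ L) →
      Integrable (fun ω => g ω ^ 2) P := fun g L hg hL => (memLp_of_abs_le hg hL 2).integrable_sq
  have hdiff : ∀ {f : (ι → ℝ) → ℝ}, Measurable f → (∀ x, |f x| ≤ K) → ∀ i,
      Integrable (fun ω =>
        (f (fun k => X k ω) - f (Function.update (fun k => X k ω) i 0)) ^ 2) P :=
    fun {f} hf hfK i => hint _ (K + K)
      ((hf.comp hXm).sub ((hf.comp measurable_update_left).comp hXm))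
      fun ω => (abs_sub _ _).trans (add_le_add (hfK _) (hfK _))
  -- The complex variance and the squared modulus both split into real and imaginary parts, so the
  -- real inequality applies to each.
  have hvar : complexVar P (fun ω => F (fun i => X i ω)) =
      Var[fun ω => (F (fun i => X i ω)).re; P] + Var[fun ω => (F (fun i => X i ω)).im; P] := by
    have hreX : Measurable fun ω => (F fun i => X i ω).re := hre.comp hXm
    have himX : Measurable fun ω => (F fun i => X i ω).im := him.comp hXm
    rw [variance_eq_integral hreX.aemeasurable,
      variance_eq_integral himX.aemeasurable, complexVar, ← integral_add]
    · refine integral_congr_ae (Filter.Eventually.of_forall fun ω => ?_)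
      have h1 : (∫ ω, F (fun i => X i ω) ∂P).re = ∫ ω, (F (fun i => X i ω)).re ∂P :=
        (integral_re hFX).symm
      have h2 : (∫ ω, F (fun i => X i ω) ∂P).im = ∫ ω, (F (fun i => X i ω)).im ∂P :=
        (integral_im hFX).symm
      simp only
      rw [hsq, Complex.sub_re, Complex.sub_im, h1, h2]
    · exact hint _ (K + |∫ ω, (F (fun i => X i ω)).re ∂P|) (hreX.sub_const _)
        fun ω => (abs_sub _ _).trans (add_le_add_left (hreK _) _)
    · exact hint _ (K + |∫ ω, (F (fun i => X i ω)).im ∂P|) (himX.sub_const _)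
        fun ω => (abs_sub _ _).trans (add_le_add_left (himK _) _)
  rw [hvar]
  refine (add_le_add (variance_comp_le_sum hX hind hre hreK)
    (variance_comp_le_sum hX hind him himK)).trans (le_of_eq ?_)
  rw [← Finset.sum_add_distrib]
  refine Finset.sum_congr rfl fun i _ => ?_
  rw [← integral_add (hdiff hre hreK i) (hdiff him himK i)]
  simp_rw [hsq, Complex.sub_re, Complex.sub_im]

/-- A coordinate of an independent family is independent of the family with this coordinate
replaced by zero. -/
theorem indepFun_update_zero {Ω ι : Type*} [Fintype ι] [DecidableEq ι] [MeasurableSpace Ω]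
    {P : Measure Ω} {X : ι → Ω → ℝ} (hX : ∀ i, Measurable (X i)) (hind : iIndepFun X P) (i : ι) :
    IndepFun (X i) (fun ω => Function.update (fun k => X k ω) i 0) P := by
  have h := hind.indepFun_finset {i} {i}ᶜ disjoint_compl_right hX
  have hφ : Measurable fun y : ({i} : Finset ι) → ℝ => y ⟨i, Finset.mem_singleton_self i⟩ :=
    measurable_pi_apply _
  have h2 := h.comp (φ := fun y : ({i} : Finset ι) → ℝ => y ⟨i, Finset.mem_singleton_self i⟩)
    (ψ := fun (y : (({i}ᶜ : Finset ι)) → ℝ) (k : ι) =>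
      if hk : k ∈ ({i}ᶜ : Finset ι) then y ⟨k, hk⟩ else 0)
    hφ (measurable_pi_lambda _ fun k => by
      by_cases hk : k ∈ ({i}ᶜ : Finset ι)
      · simp only [hk, dif_pos]
        exact measurable_pi_apply _
      · simp only [hk, dif_neg, not_false_iff]
        exact measurable_const)
  convert h2 using 1
  · funext ω
    rfl
  · funext ω k
    by_cases hk : k = i
    · subst hk
      simp
    · simp [hk]

end EfronStein

/-! ### Variance of a diagonal entry of `exp(iA)` for independent entries. -/

section WignerVariance

/-- The positions on and above the diagonal of an `n × n` matrix. -/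
abbrev UpperIndex (n : ℕ) : Type := {p : Fin n × Fin n // p.1 ≤ p.2}

/-- The symmetric matrix with prescribed entries on and above the diagonal. -/
def symmMatrix {n : ℕ} (x : UpperIndex n → ℝ) : Matrix (Fin n) (Fin n) ℝ :=
  Matrix.of fun c d => x ⟨(min c d, max c d), min_le_max⟩

variable {n : ℕ}

theorem symmMatrix_isSymm (x : UpperIndex n → ℝ) : (symmMatrix x).IsSymm := by
  ext c d
  simp [symmMatrix, min_comm, max_comm]

theorem smul_symmMatrix_isSymm (r : ℝ) (x : UpperIndex n → ℝ) : (r • symmMatrix x).IsSymm :=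
  (symmMatrix_isSymm x).smul r

theorem eq_symmMatrix {A : Matrix (Fin n) (Fin n) ℝ} (hA : A.IsSymm) :
    A = symmMatrix fun p : UpperIndex n => A p.1.1 p.1.2 := by
  ext c d
  rcases le_total c d with h | h
  · simp [symmMatrix, h]
  · simpa [symmMatrix, h] using hA.apply d c

theorem continuous_smul_symmMatrix (r : ℝ) :
    Continuous fun x : UpperIndex n → ℝ => r • symmMatrix x := by
  have h : Continuous fun x : UpperIndex n → ℝ => symmMatrix x :=
    continuous_matrix fun c d => continuous_apply _
  exact h.const_smul r

theorem differsAt_update (r : ℝ) (x : UpperIndex n → ℝ) (p : UpperIndex n) :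
    DiffersAt (r • symmMatrix x) (r • symmMatrix (Function.update x p 0)) p.1.1 p.1.2
      |r * x p| := by
  intro c d
  simp only [Matrix.smul_apply, symmMatrix, Matrix.of_apply, smul_eq_mul]
  set q : UpperIndex n := ⟨(min c d, max c d), min_le_max⟩ with hq
  by_cases h : q = p
  · rw [h, Function.update_self, mul_zero, sub_zero]
    refine le_mul_of_one_le_right (abs_nonneg _) ?_
    rw [← h]
    rcases le_total c d with hcd | hcd
    · simp only [hq, hcd, min_eq_left, max_eq_right, and_self, if_true]
      split_ifs <;> norm_num
    · simp only [hq, hcd, min_eq_right, max_eq_left, and_self, if_true]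
      split_ifs <;> norm_num
  · rw [Function.update_of_ne h, sub_self, abs_zero]
    refine mul_nonneg (abs_nonneg _) ?_
    split_ifs <;> norm_num

theorem continuous_norm_unitaryExp (c j : Fin n) :
    Continuous fun p : Matrix (Fin n) (Fin n) ℝ × ℝ => ‖unitaryExp p.1 p.2 c j‖ :=
  (continuous_unitaryExp.matrix_elem c j).norm

theorem continuous_rowMass (j a b : Fin n) :
    Continuous fun A : Matrix (Fin n) (Fin n) ℝ => rowMass A j a b :=
  intervalIntegral.continuous_parametric_intervalIntegral_of_continuous'
    (f := fun (A : Matrix (Fin n) (Fin n) ℝ) s => ‖unitaryExp A s a j‖ + ‖unitaryExp A s b j‖)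
    ((continuous_norm_unitaryExp a j).add (continuous_norm_unitaryExp b j)) 0 1

theorem continuous_overlap (j a b : Fin n) :
    Continuous fun A : Matrix (Fin n) (Fin n) ℝ => overlap A j a b :=
  intervalIntegral.continuous_parametric_intervalIntegral_of_continuous'
    (f := fun (A : Matrix (Fin n) (Fin n) ℝ) s =>
      ‖unitaryExp A (1 - s) a j‖ * ‖unitaryExp A s b j‖)
    (((continuous_norm_unitaryExp a j).comp
      (continuous_fst.prodMk (continuous_const.sub continuous_snd))).mul
      (continuous_norm_unitaryExp b j)) 0 1

theorem sum_upperIndex_le {f : Fin n → Fin n → ℝ} (hf : ∀ a b, 0 ≤ f a b) :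
    ∑ p : UpperIndex n, f p.1.1 p.1.2 ≤ ∑ a, ∑ b, f a b := by
  rw [← Finset.sum_product', Finset.univ_product_univ,
    ← Finset.sum_subtype (Finset.univ.filter fun p : Fin n × Fin n => p.1 ≤ p.2)
      (by simp) (fun p => f p.1 p.2)]
  exact Finset.sum_le_sum_of_subset_of_nonneg (Finset.filter_subset _ _) fun _ _ _ => hf _ _

variable {Ω : Type*} [MeasurableSpace Ω] {P : Measure Ω} [IsProbabilityMeasure P]
  {X : UpperIndex n → Ω → ℝ}

/-- The effect on a diagonal entry of `exp (iA)` of deleting one matrix element. -/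
theorem integral_norm_sub_update_sq_le (hX : ∀ p, Measurable (X p)) (hind : iIndepFun X P)
    {m : ℝ} (hm4 : ∀ p, Integrable (fun ω => X p ω ^ 4) P ∧ ∫ ω, X p ω ^ 4 ∂P ≤ m)
    (hm2 : ∀ p, Integrable (fun ω => X p ω ^ 2) P ∧ ∫ ω, X p ω ^ 2 ∂P ≤ m)
    (r : ℝ) (j : Fin n) (p : UpperIndex n) :
    ∫ ω, ‖unitaryExp (r • symmMatrix fun k => X k ω) 1 j j -
        unitaryExp (r • symmMatrix (Function.update (fun k => X k ω) p 0)) 1 j j‖ ^ 2 ∂P ≤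
      16 * (r ^ 2 * m) *
          ∫ ω, overlap (r • symmMatrix fun k => X k ω) j p.1.1 p.1.2 ^ 2 ∂P +
        (512 * (r ^ 2 * m) ^ 2 + 16 * (r ^ 4 * m)) *
          ∫ ω, rowMass (r • symmMatrix fun k => X k ω) j p.1.1 p.1.2 ^ 2 ∂P +
        (8192 * (r ^ 2 * m) ^ 3 + 256 * (r ^ 4 * m) * (r ^ 2 * m)) := by
  set A : Ω → Matrix (Fin n) (Fin n) ℝ := fun ω => r • symmMatrix fun k => X k ω with hA
  set B : Ω → Matrix (Fin n) (Fin n) ℝ :=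
    fun ω => r • symmMatrix (Function.update (fun k => X k ω) p 0) with hB
  set Q : (UpperIndex n → ℝ) → ℝ := fun x => overlap (r • symmMatrix x) j p.1.1 p.1.2 with hQ
  set Y : (UpperIndex n → ℝ) → ℝ := fun x => rowMass (r • symmMatrix x) j p.1.1 p.1.2 with hY
  set d : Ω → ℝ := fun ω => |r * X p ω| with hd
  set x : Ω → UpperIndex n → ℝ := fun ω k => X k ω with hx
  set x₀ : Ω → UpperIndex n → ℝ := fun ω => Function.update (fun k => X k ω) p 0 with hx₀
  have hQm : Measurable Q := ((continuous_overlap _ _ _).comp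
    (continuous_smul_symmMatrix r)).measurable
  have hYm : Measurable Y := ((continuous_rowMass _ _ _).comp
    (continuous_smul_symmMatrix r)).measurable
  have hxm : Measurable x := measurable_pi_lambda _ hX
  have hx₀m : Measurable x₀ := measurable_update_left.comp hxm
  have hQ0 : ∀ z, 0 ≤ Q z := fun z => overlap_nonneg _ _ _ _
  have hY0 : ∀ z, 0 ≤ Y z := fun z => rowMass_nonneg _ _ _ _
  have hQ1 : ∀ z, |Q z| ≤ 1 := fun z => by
    rw [abs_of_nonneg (hQ0 z)]
    exact overlap_le (smul_symmMatrix_isSymm r z) _ _ _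
  have hY2 : ∀ z, |Y z| ≤ 2 := fun z => by
    rw [abs_of_nonneg (hY0 z)]
    exact rowMass_le (smul_symmMatrix_isSymm r z) _ _ _
  have iQ : Integrable (fun ω => Q (x ω) ^ 2) P :=
    (memLp_of_abs_le (hQm.comp hxm) (fun ω => hQ1 _) 2).integrable_sq
  have iQ₀ : Integrable (fun ω => Q (x₀ ω) ^ 2) P :=
    (memLp_of_abs_le (hQm.comp hx₀m) (fun ω => hQ1 _) 2).integrable_sq
  have iY : Integrable (fun ω => Y (x ω) ^ 2) P :=
    (memLp_of_abs_le (hYm.comp hxm) (fun ω => hY2 _) 2).integrable_sq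
  have iY₀ : Integrable (fun ω => Y (x₀ ω) ^ 2) P :=
    (memLp_of_abs_le (hYm.comp hx₀m) (fun ω => hY2 _) 2).integrable_sq
  have hd0 : ∀ ω, 0 ≤ d ω := fun ω => abs_nonneg _
  have hd2 : ∀ ω, d ω ^ 2 = r ^ 2 * X p ω ^ 2 := fun ω => by rw [hd, sq_abs, mul_pow]
  have hd4 : ∀ ω, d ω ^ 4 = r ^ 4 * X p ω ^ 4 := fun ω => by
    rw [show d ω ^ 4 = (d ω ^ 2) ^ 2 by ring, hd2]
    ring
  have id2 : Integrable (fun ω => d ω ^ 2) P := by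
    simp_rw [hd2]
    exact (hm2 p).1.const_mul _
  have id4 : Integrable (fun ω => d ω ^ 4) P := by
    simp_rw [hd4]
    exact (hm4 p).1.const_mul _
  have ed2 : ∫ ω, d ω ^ 2 ∂P ≤ r ^ 2 * m := by
    simp_rw [hd2]
    rw [integral_const_mul]
    exact mul_le_mul_of_nonneg_left (hm2 p).2 (sq_nonneg r)
  have ed4 : ∫ ω, d ω ^ 4 ∂P ≤ r ^ 4 * m := by
    simp_rw [hd4]
    rw [integral_const_mul]
    exact mul_le_mul_of_nonneg_left (hm4 p).2 (by positivity)
  -- The deleted configuration `x₀` does not involve `X p`, so powers of `d` factor out of the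
  -- expectations.
  have hindep : ∀ (f : ℝ → ℝ) (g : (UpperIndex n → ℝ) → ℝ), Measurable f → Measurable g →
      IndepFun (fun ω => f (X p ω)) (fun ω => g (x₀ ω)) P := fun f g hf hg =>
    (indepFun_update_zero hX hind p).comp hf hg
  have h2 : ∀ g : (UpperIndex n → ℝ) → ℝ, Measurable g → Integrable (fun ω => g (x₀ ω) ^ 2) P →
      Integrable (fun ω => d ω ^ 2 * g (x₀ ω) ^ 2) P ∧
      ∫ ω, d ω ^ 2 * g (x₀ ω) ^ 2 ∂P ≤ r ^ 2 * m * ∫ ω, g (x₀ ω) ^ 2 ∂P := fun g hg hi => by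
    have hI : IndepFun (fun ω => d ω ^ 2) (fun ω => g (x₀ ω) ^ 2) P :=
      hindep (fun y => |r * y| ^ 2) (fun z => g z ^ 2) (by fun_prop) (by fun_prop)
    refine ⟨hI.integrable_mul id2 hi, ?_⟩
    rw [hI.integral_fun_mul_eq_mul_integral id2.aestronglyMeasurable hi.aestronglyMeasurable]
    exact mul_le_mul_of_nonneg_right ed2 (integral_nonneg fun ω => sq_nonneg _)
  have h4 : Integrable (fun ω => d ω ^ 4 * Y (x₀ ω) ^ 2) P ∧
      ∫ ω, d ω ^ 4 * Y (x₀ ω) ^ 2 ∂P ≤ r ^ 4 * m * ∫ ω, Y (x₀ ω) ^ 2 ∂P := by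
    have hI : IndepFun (fun ω => d ω ^ 4) (fun ω => Y (x₀ ω) ^ 2) P :=
      hindep (fun y => |r * y| ^ 4) (fun z => Y z ^ 2) (by fun_prop) (by fun_prop)
    refine ⟨hI.integrable_mul id4 iY₀, ?_⟩
    rw [hI.integral_fun_mul_eq_mul_integral id4.aestronglyMeasurable iY₀.aestronglyMeasurable]
    exact mul_le_mul_of_nonneg_right ed4 (integral_nonneg fun ω => sq_nonneg _)
  have hdiff : ∀ ω, DiffersAt (A ω) (B ω) p.1.1 p.1.2 (d ω) := fun ω => differsAt_update r _ p
  have hAs : ∀ ω, (A ω).IsSymm := fun ω => smul_symmMatrix_isSymm r _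
  have hBs : ∀ ω, (B ω).IsSymm := fun ω => smul_symmMatrix_isSymm r _
  -- Since `x₀` depends on `p`, the later sum over `p` requires returning to `x`. The constant is
  -- `32 = 2 · 4²`.
  have boundY : ∫ ω, Y (x₀ ω) ^ 2 ∂P ≤ 2 * ∫ ω, Y (x ω) ^ 2 ∂P + 32 * (r ^ 2 * m) := by
    calc ∫ ω, Y (x₀ ω) ^ 2 ∂P ≤ ∫ ω, (2 * Y (x ω) ^ 2 + 32 * d ω ^ 2) ∂P := by
          refine integral_mono iY₀ ((iY.const_mul 2).add (id2.const_mul 32)) fun ω => ?_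
          have h : Y (x₀ ω) ≤ Y (x ω) + 4 * d ω :=
            (hdiff ω).symm.rowMass_le (hd0 ω) (hBs ω) (hAs ω) j
          have h' := pow_le_pow_left₀ (hY0 _) h 2
          simp only
          nlinarith [sq_nonneg (Y (x ω) - 4 * d ω)]
      _ = 2 * ∫ ω, Y (x ω) ^ 2 ∂P + 32 * ∫ ω, d ω ^ 2 ∂P := by
          rw [integral_add (iY.const_mul 2) (id2.const_mul 32), integral_const_mul,
            integral_const_mul]
      _ ≤ _ := by gcongr
  have boundQ : ∫ ω, Q (x₀ ω) ^ 2 ∂P ≤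
      2 * ∫ ω, Q (x ω) ^ 2 ∂P + 32 * (r ^ 2 * m * ∫ ω, Y (x₀ ω) ^ 2 ∂P) := by
    have hdY := h2 Y hYm iY₀
    calc ∫ ω, Q (x₀ ω) ^ 2 ∂P
        ≤ ∫ ω, (2 * Q (x ω) ^ 2 + 32 * (d ω ^ 2 * Y (x₀ ω) ^ 2)) ∂P := by
          refine integral_mono iQ₀ ((iQ.const_mul 2).add (hdY.1.const_mul 32)) fun ω => ?_
          have h : Q (x₀ ω) ≤ Q (x ω) + 4 * d ω * Y (x₀ ω) :=
            (hdiff ω).overlap_le (hd0 ω) (hAs ω) (hBs ω) j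
          have h' := pow_le_pow_left₀ (hQ0 _) h 2
          simp only
          nlinarith [sq_nonneg (Q (x ω) - 4 * d ω * Y (x₀ ω))]
      _ = 2 * ∫ ω, Q (x ω) ^ 2 ∂P + 32 * ∫ ω, d ω ^ 2 * Y (x₀ ω) ^ 2 ∂P := by
          rw [integral_add (iQ.const_mul 2) (hdY.1.const_mul 32), integral_const_mul,
            integral_const_mul]
      _ ≤ _ := by gcongr; exact hdY.2
  have main : ∫ ω, ‖unitaryExp (A ω) 1 j j - unitaryExp (B ω) 1 j j‖ ^ 2 ∂P ≤
      8 * (r ^ 2 * m * ∫ ω, Q (x₀ ω) ^ 2 ∂P) + 8 * (r ^ 4 * m * ∫ ω, Y (x₀ ω) ^ 2 ∂P) := by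
    have hdQ := h2 Q hQm iQ₀
    calc ∫ ω, ‖unitaryExp (A ω) 1 j j - unitaryExp (B ω) 1 j j‖ ^ 2 ∂P
        ≤ ∫ ω, (8 * (d ω ^ 2 * Q (x₀ ω) ^ 2) + 8 * (d ω ^ 4 * Y (x₀ ω) ^ 2)) ∂P := by
          refine integral_mono_of_nonneg (Filter.Eventually.of_forall fun ω => by positivity)
            ((hdQ.1.const_mul 8).add (h4.1.const_mul 8))
            (Filter.Eventually.of_forall fun ω => ?_)
          have h : ‖unitaryExp (A ω) 1 j j - unitaryExp (B ω) 1 j j‖ ≤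
              2 * d ω * Q (x₀ ω) + 2 * d ω ^ 2 * Y (x₀ ω) :=
            (hdiff ω).norm_sub_diag_le (hd0 ω) (hAs ω) (hBs ω) j
          have h' := pow_le_pow_left₀ (norm_nonneg _) h 2
          simp only
          nlinarith [sq_nonneg (2 * d ω * Q (x₀ ω) - 2 * d ω ^ 2 * Y (x₀ ω))]
      _ = 8 * ∫ ω, d ω ^ 2 * Q (x₀ ω) ^ 2 ∂P + 8 * ∫ ω, d ω ^ 4 * Y (x₀ ω) ^ 2 ∂P := by
          rw [integral_add (hdQ.1.const_mul 8) (h4.1.const_mul 8), integral_const_mul,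
            integral_const_mul]
      _ ≤ _ := by gcongr; exacts [hdQ.2, h4.2]
  have hm0 : 0 ≤ m := le_trans (integral_nonneg fun ω => by positivity) (hm2 p).2
  refine main.trans ?_
  have e2 : 0 ≤ r ^ 2 * m := by positivity
  have e4 : 0 ≤ r ^ 4 * m := by positivity
  set α := r ^ 2 * m
  set β := r ^ 4 * m
  set q := ∫ ω, Q (x ω) ^ 2 ∂P
  set y := ∫ ω, Y (x ω) ^ 2 ∂P
  calc 8 * (α * ∫ ω, Q (x₀ ω) ^ 2 ∂P) + 8 * (β * ∫ ω, Y (x₀ ω) ^ 2 ∂P)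
      ≤ 8 * (α * (2 * q + 32 * (α * (2 * y + 32 * α)))) + 8 * (β * (2 * y + 32 * α)) := by
        gcongr
        refine boundQ.trans ?_
        gcongr
    _ = 16 * α * q + (512 * α ^ 2 + 16 * β) * y + (8192 * α ^ 3 + 256 * β * α) := by ring

/-- The variance of a diagonal entry of `exp (iA)` for a random symmetric matrix `A` with
independent entries. -/
theorem complexVar_unitaryExp_le (hX : ∀ p, Measurable (X p)) (hind : iIndepFun X P)
    {m : ℝ} (hm4 : ∀ p, Integrable (fun ω => X p ω ^ 4) P ∧ ∫ ω, X p ω ^ 4 ∂P ≤ m)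
    (hm2 : ∀ p, Integrable (fun ω => X p ω ^ 2) P ∧ ∫ ω, X p ω ^ 2 ∂P ≤ m)
    (hm0 : 0 ≤ m) (r : ℝ) (j : Fin n) :
    complexVar P (fun ω => unitaryExp (r • symmMatrix fun k => X k ω) 1 j j) ≤
      16 * (r ^ 2 * m) + (512 * (r ^ 2 * m) ^ 2 + 16 * (r ^ 4 * m)) * (4 * n) +
        (8192 * (r ^ 2 * m) ^ 3 + 256 * (r ^ 4 * m) * (r ^ 2 * m)) * (n : ℝ) ^ 2 := by
  have hxm : Measurable fun ω k => X k ω := measurable_pi_lambda _ hX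
  have hsymm : ∀ ω, (r • symmMatrix fun k => X k ω).IsSymm := fun ω => smul_symmMatrix_isSymm r _
  have hF : Measurable fun x : UpperIndex n → ℝ => unitaryExp (r • symmMatrix x) 1 j j :=
    ((continuous_unitaryExp.comp
      ((continuous_smul_symmMatrix r).prodMk continuous_const)).matrix_elem j j).measurable
  have iQ : ∀ p : UpperIndex n, Integrable
      (fun ω => overlap (r • symmMatrix fun k => X k ω) j p.1.1 p.1.2 ^ 2) P := fun p =>
    (memLp_of_abs_le ((((continuous_overlap _ _ _).comp
      (continuous_smul_symmMatrix r)).measurable).comp hxm) (K := 1) (fun ω => by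
        simp only [Function.comp_apply]
        rw [abs_of_nonneg (overlap_nonneg _ _ _ _)]
        exact overlap_le (hsymm ω) _ _ _) 2).integrable_sq
  have iY : ∀ p : UpperIndex n, Integrable
      (fun ω => rowMass (r • symmMatrix fun k => X k ω) j p.1.1 p.1.2 ^ 2) P := fun p =>
    (memLp_of_abs_le ((((continuous_rowMass _ _ _).comp
      (continuous_smul_symmMatrix r)).measurable).comp hxm) (K := 2) (fun ω => by
        simp only [Function.comp_apply]
        rw [abs_of_nonneg (rowMass_nonneg _ _ _ _)]
        exact rowMass_le (hsymm ω) _ _ _) 2).integrable_sq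
  refine (complexVar_comp_le_sum hX hind hF (K := 1)
    fun x => norm_unitaryExp_le (smul_symmMatrix_isSymm r x) _ _ _).trans ?_
  refine (Finset.sum_le_sum fun p _ =>
    integral_norm_sub_update_sq_le hX hind hm4 hm2 r j p).trans ?_
  rw [Finset.sum_add_distrib, Finset.sum_add_distrib, ← Finset.mul_sum, ← Finset.mul_sum,
    ← integral_finsetSum _ fun p _ => iQ p, ← integral_finsetSum _ fun p _ => iY p]
  have sQ : ∫ ω, ∑ p : UpperIndex n,
      overlap (r • symmMatrix fun k => X k ω) j p.1.1 p.1.2 ^ 2 ∂P ≤ 1 := by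
    calc _ ≤ ∫ ω, (1 : ℝ) ∂P := integral_mono (integrable_finsetSum _ fun p _ => iQ p)
          (integrable_const _) fun ω => (sum_upperIndex_le fun a b => sq_nonneg _).trans
            (sum_overlap_sq_le (hsymm ω) j)
      _ = 1 := by simp
  have sY : ∫ ω, ∑ p : UpperIndex n,
      rowMass (r • symmMatrix fun k => X k ω) j p.1.1 p.1.2 ^ 2 ∂P ≤ 4 * n := by
    calc _ ≤ ∫ ω, (4 * n : ℝ) ∂P := integral_mono (integrable_finsetSum _ fun p _ => iY p)
          (integrable_const _) fun ω => (sum_upperIndex_le fun a b => sq_nonneg _).trans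
            (sum_rowMass_sq_le (hsymm ω) j)
      _ = 4 * n := by simp
  have hcard : (Fintype.card (UpperIndex n) : ℝ) ≤ (n : ℝ) ^ 2 := by
    have h := Fintype.card_subtype_le fun p : Fin n × Fin n => p.1 ≤ p.2
    rw [Fintype.card_prod, Fintype.card_fin] at h
    rw [sq]
    exact_mod_cast h
  rw [Finset.sum_const, Finset.card_univ, nsmul_eq_mul, mul_comm (Fintype.card _ : ℝ)]
  refine add_le_add (add_le_add ?_ ?_) ?_
  · exact mul_le_of_le_one_right (by positivity) sQ
  · exact mul_le_mul_of_nonneg_left sY (by positivity)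
  · exact mul_le_mul_of_nonneg_left hcard (by positivity)

end WignerVariance

/-! ### Fourier inversion from the distributional definition. -/

section FourierInversion

open scoped ContDiff

theorem norm_exp_I_mul_mul (t x : ℝ) : ‖Complex.exp (Complex.I * t * x)‖ = 1 := by
  rw [Complex.norm_exp]
  simp

theorem integrable_exp_mul {φhat : ℝ → ℂ} (h : Integrable φhat) (x : ℝ) :
    Integrable fun t : ℝ => Complex.exp (Complex.I * t * x) * φhat t :=
  h.bdd_mul (c := 1)
    (by fun_prop : Continuous fun t : ℝ => Complex.exp (Complex.I * t * x)).aestronglyMeasurable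
    (Filter.Eventually.of_forall fun t => (norm_exp_I_mul_mul t x).le)

theorem continuous_integral_exp_mul {φhat : ℝ → ℂ} (h : Integrable φhat) :
    Continuous fun x : ℝ => ∫ t : ℝ, Complex.exp (Complex.I * t * x) * φhat t := by
  refine continuous_of_dominated (bound := fun t => ‖φhat t‖)
    (fun x => (integrable_exp_mul h x).aestronglyMeasurable)
    (fun x => Filter.Eventually.of_forall fun t => ?_) h.norm
    (Filter.Eventually.of_forall fun t => by fun_prop)
  rw [norm_mul, norm_exp_I_mul_mul, one_mul]

/-- Fourier inversion, tested against a Schwartz function. -/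
theorem IsFourierTransform.integral_mul_schwartz {φ φhat : ℝ → ℂ} (h : IsFourierTransform φ φhat)
    (hi : Integrable φhat) (f : 𝓢(ℝ, ℂ)) :
    ∫ x, f x * φ x = ∫ x : ℝ, f x * ∫ t : ℝ, Complex.exp (Complex.I * t * x) * φhat t := by
  have hπ : (2 * Real.pi : ℝ)⁻¹ ≠ 0 := by positivity
  -- The inverse transform, rescaled by `2π` to pass between the two conventions, gives a test
  -- function `g` with `∫ e^{-itx} g(t) dt = 2π f(x)`.
  set G : 𝓢(ℝ, ℂ) := FourierTransform.fourierInv f with hG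
  set g : 𝓢(ℝ, ℂ) := SchwartzMap.compCLMOfContinuousLinearEquiv ℂ
    (ContinuousLinearEquiv.unitsEquivAut ℝ (Units.mk0 _ hπ)) G with hg
  have hgt : ∀ t, g t = G (t * (2 * Real.pi)⁻¹) := fun t => rfl
  have hgf : ∀ t, g t = ∫ x : ℝ, Complex.exp (Complex.I * t * x) * f x := fun t => by
    rw [hgt, hG, SchwartzMap.fourierInv_coe, Real.fourierInv_eq']
    congr 1
    ext x
    rw [smul_eq_mul]
    congr 2
    simp only [RCLike.inner_apply, conj_trivial]
    push_cast
    field_simp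
  have hfg : ∀ x : ℝ, ∫ t : ℝ, Complex.exp (-(Complex.I * t * x)) * g t =
      (2 * Real.pi : ℂ) * f x := fun x => by
    have h1 : ∀ t : ℝ, Complex.exp (-(Complex.I * t * x)) * g t =
        (fun v : ℝ => Complex.exp (↑(-2 * Real.pi * v * x) * Complex.I) • G v)
          (t * (2 * Real.pi)⁻¹) := fun t => by
      simp only [hgt, smul_eq_mul]
      congr 2
      push_cast
      field_simp
    rw [integral_congr_ae (Filter.Eventually.of_forall h1),
      Measure.integral_comp_mul_right
        (fun v : ℝ => Complex.exp (↑(-2 * Real.pi * v * x) * Complex.I) • G v),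
      ← Real.fourier_real_eq_integral_exp_smul,
      ← SchwartzMap.fourier_coe, hG, FourierTransform.fourier_fourierInv_eq, inv_inv,
      abs_of_pos (by positivity)]
    simp
  have hpair := h.pairing g
  simp_rw [hfg] at hpair
  have hprod : Integrable (fun p : ℝ × ℝ =>
      Complex.exp (Complex.I * p.1 * p.2) * (φhat p.1 * f p.2)) (volume.prod volume) := by
    refine (hi.mul_prod f.integrable).bdd_mul (c := 1) ?_ ?_
    · exact (by fun_prop : Continuous
        fun p : ℝ × ℝ => Complex.exp (Complex.I * p.1 * p.2)).aestronglyMeasurable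
    · exact Filter.Eventually.of_forall fun p => (norm_exp_I_mul_mul p.1 p.2).le
  calc ∫ x, f x * φ x = (2 * Real.pi : ℂ)⁻¹ * ∫ x, φ x * ((2 * Real.pi : ℂ) * f x) := by
        rw [← integral_const_mul]
        congr 1
        ext x
        have : (Real.pi : ℂ) ≠ 0 := by exact_mod_cast Real.pi_ne_zero
        field_simp
    _ = ∫ t, φhat t * g t := hpair.symm
    _ = ∫ t : ℝ, ∫ x : ℝ, Complex.exp (Complex.I * t * x) * (φhat t * f x) := by
        congr 1
        ext t
        rw [hgf, ← integral_const_mul]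
        congr 1
        ext x
        ring
    _ = ∫ x : ℝ, ∫ t : ℝ, Complex.exp (Complex.I * t * x) * (φhat t * f x) :=
        integral_integral_swap hprod
    _ = _ := by
        congr 1
        ext x
        rw [← integral_const_mul]
        congr 1
        ext t
        ring

/-- Fourier inversion for a continuous function with integrable Fourier transform. -/
theorem IsFourierTransform.eq_integral {φ φhat : ℝ → ℂ} (h : IsFourierTransform φ φhat)
    (hφ : Continuous φ) (hi : Integrable φhat) (x : ℝ) :
    φ x = ∫ t : ℝ, Complex.exp (Complex.I * t * x) * φhat t := by
  have hψ := continuous_integral_exp_mul hi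
  have hae := ae_eq_of_integral_contDiff_smul_eq (μ := volume) hφ.locallyIntegrable
    hψ.locallyIntegrable fun g hg hc => by
      have hg₁ : HasCompactSupport (Complex.ofRealCLM ∘ g) := hc.comp_left rfl
      have hg₂ : ContDiff ℝ ∞ (Complex.ofRealCLM ∘ g) := by fun_prop
      simpa using h.integral_mul_schwartz hi (hg₁.toSchwartzMap hg₂)
  -- Continuity upgrades almost everywhere equality to equality at every point, as evaluation at
  -- eigenvalues requires.
  exact congrFun ((hφ.ae_eq_iff_eq volume hψ).1 hae) x

end FourierInversion

/-! ### Spectral representation of `φ(A)` and `exp(itA)`. -/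

section FunctionalCalculus

variable {n : ℕ} {A : Matrix (Fin n) (Fin n) ℝ}

theorem matFun_apply_self (hA : A.IsHermitian) (φ : ℝ → ℂ) (j : Fin n) :
    matFun hA φ j j = ∑ a, φ (hA.eigenvalues a) *
      ((hA.eigenvectorUnitary : Matrix (Fin n) (Fin n) ℝ) j a : ℂ) ^ 2 := by
  rw [matFun, Matrix.mul_apply]
  refine Finset.sum_congr rfl fun a _ => ?_
  rw [Matrix.mul_diagonal, Matrix.transpose_apply, Matrix.map_apply]
  ring

theorem unitaryExp_eq_matFun (hA : A.IsHermitian) (t : ℝ) :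
    unitaryExp A t = matFun hA fun x => Complex.exp (Complex.I * t * x) := by
  set O : Matrix (Fin n) (Fin n) ℝ := (hA.eigenvectorUnitary : Matrix (Fin n) (Fin n) ℝ) with hO
  have hOO : O * O.transpose = 1 := by
    have h := Unitary.coe_mul_star_self hA.eigenvectorUnitary
    rwa [Unitary.coe_star, Matrix.star_eq_conjTranspose,
      Matrix.conjTranspose_eq_transpose_of_trivial] at h
  have hmapmul : ∀ X Y : Matrix (Fin n) (Fin n) ℝ, (X * Y).map Complex.ofReal =
      X.map Complex.ofReal * Y.map Complex.ofReal := fun X Y =>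
    Matrix.map_mul (f := Complex.ofRealHom)
  set V := O.map Complex.ofReal with hV
  have hVV : V * V.transpose = 1 := by
    rw [hV, ← Matrix.transpose_map, ← hmapmul, hOO]
    exact Matrix.map_one _ Complex.ofReal_zero Complex.ofReal_one
  have hVV' : V.transpose * V = 1 := mul_eq_one_comm.1 hVV
  have hinv : V⁻¹ = V.transpose := Matrix.inv_eq_right_inv hVV
  have hdec : A.map Complex.ofReal =
      V * Matrix.diagonal (fun a => (hA.eigenvalues a : ℂ)) * V⁻¹ := by
    have h := hA.spectral_theorem
    rw [Unitary.conjStarAlgAut_apply] at h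
    conv_lhs => rw [h]
    rw [Matrix.star_eq_conjTranspose,
      Matrix.conjTranspose_eq_transpose_of_trivial, hmapmul, hmapmul, hinv, hV,
      Matrix.transpose_map, Matrix.diagonal_map Complex.ofReal_zero]
    rfl
  have hunit : IsUnit V := ⟨⟨V, V.transpose, hVV, hVV'⟩, rfl⟩
  rw [unitaryExp, hdec, ← Matrix.smul_mul, ← Matrix.mul_smul, Matrix.exp_conj _ _ hunit,
    ← Matrix.diagonal_smul, Matrix.exp_diagonal, hinv, matFun]
  congr 3
  ext a
  rw [Pi.coe_exp, Complex.exp_eq_exp_ℂ]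
  rfl

/-- Fourier inversion at each eigenvalue, summed over the finite spectrum with weights `O_ja²`. -/
theorem matFun_eq_integral_unitaryExp (hA : A.IsHermitian) {φ φhat : ℝ → ℂ}
    (h : IsFourierTransform φ φhat) (hφ : Continuous φ) (hi : Integrable φhat) (j : Fin n) :
    matFun hA φ j j = ∫ t, φhat t * unitaryExp A t j j := by
  simp_rw [matFun_apply_self, unitaryExp_eq_matFun hA, matFun_apply_self, Finset.mul_sum]
  rw [integral_finsetSum]
  · refine Finset.sum_congr rfl fun a _ => ?_
    rw [h.eq_integral hφ hi, ← integral_mul_const]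
    congr 1
    ext t
    ring
  · intro a _
    refine ((integrable_exp_mul hi (hA.eigenvalues a)).mul_const
      (((hA.eigenvectorUnitary : Matrix (Fin n) (Fin n) ℝ) j a : ℂ) ^ 2)).congr
      (Filter.Eventually.of_forall fun t => ?_)
    simp only
    ring

end FunctionalCalculus

/-! ### Variance of a superposition of random variables. -/

section VarianceOfIntegral

/-- Cauchy–Schwarz for the factors `(v|ρ|)^{1/2}` and `(|ρ| v⁻¹ |z|²)^{1/2}`, through the
discriminant of the nonnegative quadratic `x ↦ ∫ |ρ| v⁻¹ (|z| - x v)²`. -/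
theorem sq_norm_integral_mul_le {ρ z : ℝ → ℂ} {v : ℝ → ℝ} (hv : ∀ t, 0 < v t)
    (h₁ : Integrable fun t => v t * ‖ρ t‖) (h₂ : Integrable fun t => ‖ρ t‖ * ‖z t‖)
    (h₃ : Integrable fun t => ‖ρ t‖ * (v t)⁻¹ * ‖z t‖ ^ 2) :
    ‖∫ t, ρ t * z t‖ ^ 2 ≤ (∫ t, v t * ‖ρ t‖) * ∫ t, ‖ρ t‖ * (v t)⁻¹ * ‖z t‖ ^ 2 := by
  have hle : ‖∫ t, ρ t * z t‖ ≤ ∫ t, ‖ρ t‖ * ‖z t‖ := by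
    simpa only [norm_mul] using norm_integral_le_integral_norm fun t => ρ t * z t
  have hquad : ∀ x : ℝ, 0 ≤ (∫ t, v t * ‖ρ t‖) * (x * x) +
      (-2 * ∫ t, ‖ρ t‖ * ‖z t‖) * x + ∫ t, ‖ρ t‖ * (v t)⁻¹ * ‖z t‖ ^ 2 := fun x => by
    have h : 0 ≤ ∫ t, ‖ρ t‖ * (v t)⁻¹ * (‖z t‖ - x * v t) ^ 2 :=
      integral_nonneg fun t => mul_nonneg
        (mul_nonneg (norm_nonneg _) (inv_nonneg.2 (hv t).le)) (sq_nonneg _)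
    have heq : ∀ t, ‖ρ t‖ * (v t)⁻¹ * (‖z t‖ - x * v t) ^ 2 =
        x * x * (v t * ‖ρ t‖) + -2 * x * (‖ρ t‖ * ‖z t‖) + ‖ρ t‖ * (v t)⁻¹ * ‖z t‖ ^ 2 :=
      fun t => by
        have := (hv t).ne'
        field_simp
        ring
    simp_rw [heq] at h
    have h12 : Integrable fun t => x * x * (v t * ‖ρ t‖) + -2 * x * (‖ρ t‖ * ‖z t‖) :=
      (h₁.const_mul _).add (h₂.const_mul _)
    rw [integral_add h12 h₃, integral_add (h₁.const_mul _) (h₂.const_mul _), integral_const_mul,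
      integral_const_mul] at h
    linarith
  have hd := discrim_le_zero hquad
  rw [discrim] at hd
  have := pow_le_pow_left₀ (norm_nonneg _) hle 2
  nlinarith

theorem complexVar_const_mul {Ω : Type*} [MeasurableSpace Ω] {P : Measure Ω} (a : ℂ) (X : Ω → ℂ) :
    complexVar P (fun ω => a * X ω) = ‖a‖ ^ 2 * complexVar P X := by
  have h : ∀ ω, ‖a * X ω - ∫ ω', a * X ω' ∂P‖ ^ 2 = ‖a‖ ^ 2 * ‖X ω - ∫ ω', X ω' ∂P‖ ^ 2 :=
    fun ω => by rw [integral_const_mul, ← mul_sub, norm_mul, mul_pow]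
  simp_rw [complexVar, h]
  exact integral_const_mul _ _

variable {Ω : Type*} [MeasurableSpace Ω] {P : Measure Ω} [IsProbabilityMeasure P]

theorem memLp_two_integral_mul {u : Ω × ℝ → ℂ} (hu : Measurable u) (hu1 : ∀ p, ‖u p‖ ≤ 1)
    {ρ : ℝ → ℂ} (hρ : Integrable ρ) : MemLp (fun ω => ∫ t, ρ t * u (ω, t)) 2 P := by
  have hint : Integrable (fun p : Ω × ℝ => ρ p.2 * u p) (P.prod volume) :=
    (hρ.comp_snd P).mul_bdd (c := 1) hu.aestronglyMeasurable (Filter.Eventually.of_forall hu1)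
  refine MemLp.of_bound hint.integral_prod_left.aestronglyMeasurable (∫ t, ‖ρ t‖)
    (Filter.Eventually.of_forall fun ω => ?_)
  refine norm_integral_le_of_norm_le hρ.norm (Filter.Eventually.of_forall fun t => ?_)
  rw [norm_mul]
  exact mul_le_of_le_one_right (norm_nonneg _) (hu1 _)

/-- Weighted Cauchy–Schwarz bound for the variance of a superposition of random variables. -/
theorem complexVar_integral_mul_le {u : Ω × ℝ → ℂ} (hu : Measurable u) (hu1 : ∀ p, ‖u p‖ ≤ 1)
    {ρ : ℝ → ℂ} (hρ : Integrable ρ) {v : ℝ → ℝ} (hvm : Measurable v) (hv : ∀ t, 1 ≤ v t)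
    (hρv : Integrable fun t => v t * ‖ρ t‖) {c : ℝ}
    (hc : ∀ t, complexVar P (fun ω => u (ω, t)) ≤ c * v t ^ 2) :
    complexVar P (fun ω => ∫ t, ρ t * u (ω, t)) ≤ c * (∫ t, v t * ‖ρ t‖) ^ 2 := by
  set K := ∫ t, v t * ‖ρ t‖ with hK
  have hv0 : ∀ t, 0 < v t := fun t => one_pos.trans_le (hv t)
  have hK0 : 0 ≤ K := integral_nonneg fun t => mul_nonneg (hv0 t).le (norm_nonneg _)
  set e : ℝ → ℂ := fun t => ∫ ω, u (ω, t) ∂P with he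
  have hem : Measurable e := hu.stronglyMeasurable.integral_prod_left'.measurable
  have he1 : ∀ t, ‖e t‖ ≤ 1 := fun t => by
    have := norm_integral_le_of_norm_le_const (μ := P) (f := fun ω => u (ω, t))
      (Filter.Eventually.of_forall fun ω => hu1 (ω, t))
    simpa using this
  set z : Ω × ℝ → ℂ := fun p => u p - e p.2 with hz
  have hzm : Measurable z := hu.sub (hem.comp measurable_snd)
  have hz2 : ∀ p, ‖z p‖ ≤ 2 := fun p => by
    have := norm_sub_le (u p) (e p.2)
    linarith [hu1 p, he1 p.2]
  have hsec : ∀ {f : Ω × ℝ → ℂ}, Measurable f → ∀ {L : ℝ}, (∀ p, ‖f p‖ ≤ L) → ∀ ω,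
      Integrable fun t => ρ t * f (ω, t) := fun {f} hf {L} hL ω =>
    hρ.mul_bdd (c := L) (hf.comp measurable_prodMk_left).aestronglyMeasurable
      (Filter.Eventually.of_forall fun t => hL _)
  have hint : Integrable (fun p : Ω × ℝ => ρ p.2 * u p) (P.prod volume) :=
    (hρ.comp_snd P).mul_bdd (c := 1) hu.aestronglyMeasurable (Filter.Eventually.of_forall hu1)
  have hmean : ∫ ω, (∫ t, ρ t * u (ω, t)) ∂P = ∫ t, ρ t * e t := by
    rw [integral_integral_swap hint]
    congr 1
    ext t
    exact integral_const_mul _ _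
  have hcenter : ∀ ω, (∫ t, ρ t * u (ω, t)) - ∫ ω', (∫ t, ρ t * u (ω', t)) ∂P =
      ∫ t, ρ t * z (ω, t) := fun ω => by
    rw [hmean, ← integral_sub (hsec hu hu1 ω)
      (hρ.mul_bdd (c := 1) hem.aestronglyMeasurable (Filter.Eventually.of_forall he1))]
    congr 1
    ext t
    ring
  have hS : Integrable (fun p : Ω × ℝ => ‖ρ p.2‖ * (v p.2)⁻¹ * ‖z p‖ ^ 2) (P.prod volume) := by
    have h1 : Integrable (fun p : Ω × ℝ => ‖ρ p.2‖ * ((v p.2)⁻¹ * ‖z p‖ ^ 2)) (P.prod volume) := by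
      refine (hρ.norm.comp_snd P).mul_bdd (c := 4)
        ((hvm.comp measurable_snd).inv.mul (hzm.norm.pow_const 2)).aestronglyMeasurable
        (Filter.Eventually.of_forall fun p => ?_)
      have h2 : (v p.2)⁻¹ ≤ 1 := inv_le_one_of_one_le₀ (hv _)
      have h3 : 0 ≤ (v p.2)⁻¹ := inv_nonneg.2 (hv0 _).le
      have h4 : ‖z p‖ ^ 2 ≤ 2 ^ 2 := pow_le_pow_left₀ (norm_nonneg _) (hz2 p) 2
      rw [Real.norm_of_nonneg (by positivity)]
      nlinarith [sq_nonneg ‖z p‖]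
    simpa only [mul_assoc] using h1
  have hSsec : ∀ ω, Integrable fun t => ‖ρ t‖ * (v t)⁻¹ * ‖z (ω, t)‖ ^ 2 := fun ω => by
    have hzω : Measurable fun t => z (ω, t) := hzm.comp measurable_prodMk_left
    have h1 : Integrable fun t => ‖ρ t‖ * ((v t)⁻¹ * ‖z (ω, t)‖ ^ 2) := by
      refine hρ.norm.mul_bdd (c := 4)
        (hvm.inv.mul (hzω.norm.pow_const 2)).aestronglyMeasurable
        (Filter.Eventually.of_forall fun t => ?_)
      have h2 : (v t)⁻¹ ≤ 1 := inv_le_one_of_one_le₀ (hv _)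
      have h3 : 0 ≤ (v t)⁻¹ := inv_nonneg.2 (hv0 _).le
      have h4 : ‖z (ω, t)‖ ^ 2 ≤ 2 ^ 2 := pow_le_pow_left₀ (norm_nonneg _) (hz2 _) 2
      rw [Real.norm_of_nonneg (by positivity)]
      nlinarith [sq_nonneg ‖z (ω, t)‖]
    simpa only [mul_assoc] using h1
  have hpt : ∀ ω, ‖(∫ t, ρ t * u (ω, t)) - ∫ ω', (∫ t, ρ t * u (ω', t)) ∂P‖ ^ 2 ≤
      K * ∫ t, ‖ρ t‖ * (v t)⁻¹ * ‖z (ω, t)‖ ^ 2 := fun ω => by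
    rw [hcenter]
    refine sq_norm_integral_mul_le hv0 hρv ?_ (hSsec ω)
    simpa only [norm_mul] using (hsec hzm hz2 ω).norm
  -- The weight is chosen so that `v⁻¹ · v² = v`: the second Cauchy–Schwarz factor becomes `c` times
  -- the first.
  have hc0 : ∀ t, ∫ ω, ‖ρ t‖ * (v t)⁻¹ * ‖z (ω, t)‖ ^ 2 ∂P ≤ c * (v t * ‖ρ t‖) := fun t => by
    rw [integral_const_mul]
    have h1 := hc t
    have h2 : 0 ≤ ‖ρ t‖ * (v t)⁻¹ := mul_nonneg (norm_nonneg _) (inv_nonneg.2 (hv0 _).le)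
    refine (mul_le_mul_of_nonneg_left h1 h2).trans (le_of_eq ?_)
    have := (hv0 t).ne'
    field_simp
  calc complexVar P (fun ω => ∫ t, ρ t * u (ω, t))
      ≤ ∫ ω, (K * ∫ t, ‖ρ t‖ * (v t)⁻¹ * ‖z (ω, t)‖ ^ 2) ∂P :=
        integral_mono_of_nonneg (Filter.Eventually.of_forall fun ω => by positivity)
          (hS.integral_prod_left.const_mul K) (Filter.Eventually.of_forall hpt)
    _ = K * ∫ t, ∫ ω, ‖ρ t‖ * (v t)⁻¹ * ‖z (ω, t)‖ ^ 2 ∂P := by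
        rw [integral_const_mul, integral_integral_swap hS]
    _ ≤ K * ∫ t, c * (v t * ‖ρ t‖) := by
        gcongr
        · exact hS.integral_prod_right
        · exact hρv.const_mul c
        · exact fun t => hc0 t
    _ = c * K ^ 2 := by
        rw [integral_const_mul]
        ring

end VarianceOfIntegral

/-- Pointwise `x^k ≤ 1 + x^6`; it supplies the second and fourth moment bounds from the sixth. -/
theorem integral_pow_le_one_add {Ω : Type*} [MeasurableSpace Ω] {P : Measure Ω}
    [IsProbabilityMeasure P] {X : Ω → ℝ} (hX : Measurable X)
    (h6 : Integrable (fun ω => X ω ^ 6) P) {k : ℕ} (hk : k = 2 ∨ k = 4) :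
    Integrable (fun ω => X ω ^ k) P ∧ ∫ ω, X ω ^ k ∂P ≤ 1 + ∫ ω, X ω ^ 6 ∂P := by
  have hle : ∀ x : ℝ, 0 ≤ x ^ k ∧ x ^ k ≤ 1 + x ^ 6 := fun x => by
    have h0 := sq_nonneg x
    rcases hk with rfl | rfl
    · refine ⟨by positivity, ?_⟩
      nlinarith [sq_nonneg (x ^ 2 - 1), sq_nonneg x]
    · refine ⟨by positivity, ?_⟩
      nlinarith [sq_nonneg (x ^ 2 - 1), mul_nonneg h0 (sq_nonneg (x ^ 2 - 1))]
  have hint : Integrable (fun ω => 1 + X ω ^ 6) P := (integrable_const 1).add h6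
  have hk : Integrable (fun ω => X ω ^ k) P :=
    hint.mono' (hX.pow_const k).aestronglyMeasurable (Filter.Eventually.of_forall fun ω => by
      rw [Real.norm_of_nonneg (hle _).1]
      exact (hle _).2)
  refine ⟨hk, (integral_mono hk hint fun ω => (hle _).2).trans (le_of_eq ?_)⟩
  rw [integral_add (integrable_const 1) h6]
  simp

/-- The constant in the variance bounds, in terms of a bound `m` on the second and fourth
moments of the entries. -/
def varianceConstant (m : ℝ) : ℝ := 80 * m + 2304 * m ^ 2 + 8192 * m ^ 3

/-- With `r² = t²/n` every term has exactly one factor `1/n` left. Collecting powers of `m` gives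
`80 = 16 + 64` and `2304 = 2048 + 256`. -/
theorem variance_bound_le {n : ℕ} (hn : 0 < n) {m : ℝ} (hm : 0 ≤ m) (t r : ℝ)
    (hr : r = t * (Real.sqrt n)⁻¹) :
    16 * (r ^ 2 * m) + (512 * (r ^ 2 * m) ^ 2 + 16 * (r ^ 4 * m)) * (4 * n) +
        (8192 * (r ^ 2 * m) ^ 3 + 256 * (r ^ 4 * m) * (r ^ 2 * m)) * (n : ℝ) ^ 2 ≤
      varianceConstant m * (1 + |t|) ^ 6 / n := by
  have hn0 : (0 : ℝ) < n := by exact_mod_cast hn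
  have hr2 : r ^ 2 = t ^ 2 / n := by
    rw [hr, mul_pow, inv_pow, Real.sq_sqrt hn0.le]
    rfl
  have hr4 : r ^ 4 = t ^ 4 / n ^ 2 := by
    rw [show r ^ 4 = (r ^ 2) ^ 2 by ring, hr2]
    field_simp
  have h1 : 1 ≤ 1 + |t| := by linarith [abs_nonneg t]
  have ht : ∀ k ≤ 6, |t| ^ k ≤ (1 + |t|) ^ 6 := fun k hk =>
    (pow_le_pow_left₀ (abs_nonneg t) (by linarith) k).trans (pow_le_pow_right₀ h1 hk)
  have ht2 : t ^ 2 ≤ (1 + |t|) ^ 6 := by simpa using ht 2 (by norm_num)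
  have ht4 : t ^ 4 ≤ (1 + |t|) ^ 6 := by
    simpa [Even.pow_abs (show Even 4 by decide)] using ht 4 (by norm_num)
  have ht6 : t ^ 6 ≤ (1 + |t|) ^ 6 := by
    simpa [Even.pow_abs (show Even 6 by decide)] using ht 6 le_rfl
  have heq : 16 * (r ^ 2 * m) + (512 * (r ^ 2 * m) ^ 2 + 16 * (r ^ 4 * m)) * (4 * n) +
        (8192 * (r ^ 2 * m) ^ 3 + 256 * (r ^ 4 * m) * (r ^ 2 * m)) * (n : ℝ) ^ 2 =
      (16 * m * t ^ 2 + (2048 * m ^ 2 + 64 * m) * t ^ 4 +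
        (8192 * m ^ 3 + 256 * m ^ 2) * t ^ 6) / n := by
    rw [hr2, hr4]
    field_simp
    ring
  rw [heq]
  refine div_le_div_of_nonneg_right ?_ hn0.le
  calc 16 * m * t ^ 2 + (2048 * m ^ 2 + 64 * m) * t ^ 4 + (8192 * m ^ 3 + 256 * m ^ 2) * t ^ 6
      ≤ 16 * m * (1 + |t|) ^ 6 + (2048 * m ^ 2 + 64 * m) * (1 + |t|) ^ 6 +
        (8192 * m ^ 3 + 256 * m ^ 2) * (1 + |t|) ^ 6 := by gcongr
    _ = varianceConstant m * (1 + |t|) ^ 6 := by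
        unfold varianceConstant
        ring

/-! ### Application to normalized Wigner matrices and conclusion. -/

section Wigner

variable {w : ℝ} {Ω : ℕ → Type*} [∀ n, MeasurableSpace (Ω n)] {P : ∀ n, Measure (Ω n)}
  {W : ∀ n, Ω n → Matrix (Fin n) (Fin n) ℝ}

theorem IsWigner.unitaryExp_normalized (hW : IsWigner w P W) (n : ℕ) (ω : Ω n) (t : ℝ) :
    unitaryExp (normalized (W n ω)) t = unitaryExp
      ((t * (Real.sqrt n)⁻¹) • symmMatrix fun p : UpperIndex n => W n ω p.1.1 p.1.2) 1 := by
  rw [normalized, unitaryExp_smul, ← eq_symmMatrix (hW.symm n ω), unitaryExp_smul, one_mul]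

theorem IsWigner.normalized_isSymm (hW : IsWigner w P W) (n : ℕ) (ω : Ω n) :
    (normalized (W n ω)).IsSymm :=
  (hW.symm n ω).smul _

theorem IsWigner.measurable_unitaryExp (hW : IsWigner w P W) (n : ℕ) (j : Fin n) :
    Measurable fun p : Ω n × ℝ => unitaryExp (normalized (W n p.1)) p.2 j j := by
  have h1 : Measurable fun p : (UpperIndex n → ℝ) × ℝ =>
      unitaryExp ((Real.sqrt n)⁻¹ • symmMatrix p.1) p.2 j j :=
    ((continuous_unitaryExp.comp (((continuous_smul_symmMatrix _).comp continuous_fst).prodMk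
      continuous_snd)).matrix_elem j j).measurable
  have h2 : Measurable fun p : Ω n × ℝ =>
      ((fun q : UpperIndex n => W n p.1 q.1.1 q.1.2 : UpperIndex n → ℝ), p.2) :=
    (measurable_pi_lambda _ fun q : UpperIndex n =>
      (hW.measurable n q.1.1 q.1.2).comp measurable_fst).prodMk measurable_snd
  have h3 : (fun p : Ω n × ℝ => unitaryExp (normalized (W n p.1)) p.2 j j) = fun p =>
      unitaryExp ((Real.sqrt n)⁻¹ • symmMatrix fun q : UpperIndex n => W n p.1 q.1.1 q.1.2)
        p.2 j j := by
    ext p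
    rw [← eq_symmMatrix (hW.symm n p.1)]
    rfl
  rw [h3]
  exact h1.comp h2

theorem IsWigner.complexVar_unitaryExp_le [∀ n, IsProbabilityMeasure (P n)]
    (hW : IsWigner w P W) {m : ℝ} (hm : 0 ≤ m)
    (hm4 : ∀ n j k, Integrable (fun ω => W n ω j k ^ 4) (P n) ∧ ∫ ω, W n ω j k ^ 4 ∂(P n) ≤ m)
    (hm2 : ∀ n j k, Integrable (fun ω => W n ω j k ^ 2) (P n) ∧ ∫ ω, W n ω j k ^ 2 ∂(P n) ≤ m)
    (n : ℕ) (j : Fin n) (t : ℝ) :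
    complexVar (P n) (fun ω => unitaryExp (normalized (W n ω)) t j j) ≤
      varianceConstant m * (1 + |t|) ^ 6 / n := by
  simp_rw [hW.unitaryExp_normalized n _ t]
  exact (_root_.complexVar_unitaryExp_le
    (X := fun (p : UpperIndex n) ω => W n ω p.1.1 p.1.2) (fun p => hW.measurable n _ _)
    (hW.indep n) (fun p => hm4 n _ _) (fun p => hm2 n _ _) hm _ j).trans
    (variance_bound_le j.pos hm t _ rfl)

end Wigner

theorem lemmal (w w₆ : ℝ) :
    ∃ C : ℝ, ∀ (Ω : ℕ → Type*) [∀ n, MeasurableSpace (Ω n)]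
      (P : ∀ n, Measure (Ω n)) [∀ n, IsProbabilityMeasure (P n)]
      (W : ∀ n, Ω n → Matrix (Fin n) (Fin n) ℝ) (hW : IsWigner w P W) (μ₃ : ℝ),
      (∀ n j k, ∫ ω, (W n ω j k) ^ 3 ∂(P n) = μ₃) →
      (∀ n j k, Integrable (fun ω => (W n ω j k) ^ 6) (P n) ∧
        ∫ ω, (W n ω j k) ^ 6 ∂(P n) ≤ w₆) →
      (∀ φ φhat : ℝ → ℂ, Continuous φ → IsFourierTransform φ φhat →
        Integrable (fun t : ℝ => (1 + |t|) ^ 3 • φhat t) →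
        ∀ (n : ℕ) (j : Fin n),
          MemLp (fun ω => matFun (hW.isHermitian n ω) φ j j) 2 (P n) ∧
          complexVar (P n) (fun ω => (Real.sqrt n : ℂ) * matFun (hW.isHermitian n ω) φ j j) ≤
            C * (∫ t : ℝ, (1 + |t|) ^ 3 * ‖φhat t‖) ^ 2) ∧
      (∀ (n : ℕ) (j : Fin n) (t : ℝ),
        MemLp (fun ω => unitaryExp (normalized (W n ω)) t j j) 2 (P n) ∧
        complexVar (P n) (fun ω => unitaryExp (normalized (W n ω)) t j j) ≤
          C * (1 + |t|) ^ 6 / n) := by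
  -- The absolute value makes the moment bound nonnegative whatever the sign of `w₆`.
  refine ⟨varianceConstant (1 + |w₆|), ?_⟩
  intro Ω _ P _ W hW μ₃ _ h6
  have hm : 0 ≤ 1 + |w₆| := by positivity
  have hmom : ∀ k, k = 2 ∨ k = 4 → ∀ n i j, Integrable (fun ω => W n ω i j ^ k) (P n) ∧
      ∫ ω, W n ω i j ^ k ∂(P n) ≤ 1 + |w₆| := fun k hk n i j => by
    obtain ⟨h1, h2⟩ := integral_pow_le_one_add (hW.measurable n i j) (h6 n i j).1 hk
    exact ⟨h1, h2.trans (by linarith [(h6 n i j).2, le_abs_self w₆])⟩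
  have hvar := hW.complexVar_unitaryExp_le hm (hmom 4 (Or.inr rfl)) (hmom 2 (Or.inl rfl))
  have hbound : ∀ (n : ℕ) (j : Fin n) (p : Ω n × ℝ),
      ‖unitaryExp (normalized (W n p.1)) p.2 j j‖ ≤ 1 := fun n j p =>
    norm_unitaryExp_le (hW.normalized_isSymm n p.1) _ _ _
  refine ⟨fun φ φhat hφ hF hint n j => ?_, fun n j t => ⟨?_, hvar n j t⟩⟩
  · have hv1 : ∀ t : ℝ, 1 ≤ (1 + |t|) ^ 3 := fun t =>
      one_le_pow₀ (by linarith [abs_nonneg t])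
    have hvc : Continuous fun t : ℝ => (1 + |t|) ^ 3 := by fun_prop
    have hi : Integrable φhat := by
      have h := hint.bdd_mul (f := fun t : ℝ => ((((1 + |t|) ^ 3)⁻¹ : ℝ) : ℂ)) (c := 1)
        (Complex.continuous_ofReal.comp
          (hvc.inv₀ fun t => (one_pos.trans_le (hv1 t)).ne')).aestronglyMeasurable
        (Filter.Eventually.of_forall fun t => by
          rw [Complex.norm_real, Real.norm_of_nonneg
            (inv_nonneg.2 (zero_le_one.trans (hv1 t)))]
          exact inv_le_one_of_one_le₀ (hv1 t))
      refine h.congr (Filter.Eventually.of_forall fun t => ?_)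
      have h0 : (((1 + |t|) ^ 3 : ℝ) : ℂ) ≠ 0 := by
        exact_mod_cast (one_pos.trans_le (hv1 t)).ne'
      simp only [Complex.real_smul, Complex.ofReal_inv]
      rw [← mul_assoc, inv_mul_cancel₀ h0, one_mul]
    have hnorm : Integrable fun t : ℝ => (1 + |t|) ^ 3 * ‖φhat t‖ := by
      refine hint.norm.congr (Filter.Eventually.of_forall fun t => ?_)
      simp only [norm_smul]
      rw [Real.norm_of_nonneg (zero_le_one.trans (hv1 t))]
    have hrep : ∀ ω, matFun (hW.isHermitian n ω) φ j j =
        ∫ t, φhat t * unitaryExp (normalized (W n ω)) t j j := fun ω =>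
      matFun_eq_integral_unitaryExp _ hF hφ hi j
    simp_rw [hrep]
    refine ⟨memLp_two_integral_mul (hW.measurable_unitaryExp n j) (hbound n j) hi, ?_⟩
    have hn0 : (0 : ℝ) < n := by exact_mod_cast j.pos
    rw [complexVar_const_mul, Complex.norm_real, Real.norm_of_nonneg (Real.sqrt_nonneg _),
      Real.sq_sqrt hn0.le]
    -- The weight is `v = (1 + |t|)^3`, whose square is the growth of `Var U_jj(t)`; the factor
    -- `1/n` in `c` cancels the `n` coming from `√n`.
    have h := complexVar_integral_mul_le (P := P n) (hW.measurable_unitaryExp n j) (hbound n j) hi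
      hvc.measurable hv1 hnorm (c := varianceConstant (1 + |w₆|) / n) fun t => by
        refine (hvar n j t).trans (le_of_eq ?_)
        ring
    refine (mul_le_mul_of_nonneg_left h hn0.le).trans (le_of_eq ?_)
    field_simp
  · exact MemLp.of_bound ((hW.measurable_unitaryExp n j).comp
      measurable_prodMk_right).aestronglyMeasurable 1
      (Filter.Eventually.of_forall fun ω => hbound n j (ω, t))
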